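/- **Theorem 1.1 (Cutoff for the Ornstein–Uhlenbeck process, mean-field regime).** For each $n\ge 1$ let $z_0^n\in\mathbb{R}^n$ and let $Z^n=(Z^n_t)_{t\ge 0}$ be the Ornstein–Uhlenbeck process in $\mathbb{R}^n$ solving $$Z^n_0=z^n_0,\qquad \mathrm{d}Z^n_t=\sqrt{\tfrac{2}{n}}\,\mathrm{d}B^n_t-Z^n_t\,\mathrm{d}t,$$ where $B^n$ is a standard $n$-dimensional Brownian motion, and let $P_n^0=\mathcal{N}(0,\frac1n I_n)$ be its invariant law. Suppose that $$\liminf_{n\to\infty}\frac{|z^n_0|^2}{n}>0\quad\text{and}\quad\limsup_{n\to\infty}\frac{|z^n_0|^2}{n}<\infty,$$ where $|\cdot|$ is the Euclidean norm. Then for every $\mathrm{dist}\in\{\mathrm{Wasserstein},\mathrm{TV},\mathrm{Hellinger},\mathrm{Kullback},\chi^2,\mathrm{Fisher}\}$ and every $\varepsilon\in(0,1)$, $$\lim_{n\to\infty}\mathrm{dist}(\mathrm{Law}(Z^n_{t_n})\mid P_n^0)=\begin{cases}\max&\text{if }t_n=(1-\varepsilon)c_n,\\0&\text{if }t_n=(1+\varepsilon)c_n,\end{cases}$$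 where $$c_n=\begin{cases}\frac12\log n&\text{if }\mathrm{dist}=\mathrm{Wasserstein},\\ \log n&\text{if }\mathrm{dist}\in\{\mathrm{TV},\mathrm{Hellinger},\mathrm{Kullback},\chi^2\},\\ \frac32\log n&\text{if }\mathrm{dist}=\mathrm{Fisher},\end{cases}$$ and $\max=1$ for $\mathrm{TV}$ and $\mathrm{Hellinger}$, while $\max=+\infty$ for $\mathrm{Wasserstein}$, $\mathrm{Kullback}$, $\chi^2$ and $\mathrm{Fisher}$. Here, for probability measures $\mu,\nu$ on $\mathbb{R}^n$: $\mathrm{Wasserstein}(\mu,\nu)=\bigl(\inf\mathbb{E}|X-Y|^2\bigr)^{1/2}$, the infimum being over all couplings $X\sim\mu$, $Y\sim\nu$; $\mathrm{TV}$ is $\sup_A|\mu(A)-\nu(A)|$ over Borel sets $A$; $\mathrm{Hellinger}(\mu,\nu)=\bigl(\int\frac12(\sqrt{f_\mu}-\sqrt{f_\nu})^2\,\mathrm{d}\lambda\bigr)^{1/2}$, where $f_\mu,f_\nu$ are the densities with respect to any common dominating measure $\lambda$; and, if $\nu\ll\mu$ with $f=\frac{\mathrm{d}\nu}{\mathrm{d}\mu}$,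 $\mathrm{Kullback}(\nu\mid\mu)=\int\log f\,\mathrm{d}\nu$, $\chi^2(\nu\mid\mu)=\int|f-1|^2\,\mathrm{d}\mu$, and $\mathrm{Fisher}(\nu\mid\mu)=4\int|\nabla\sqrt f|^2\,\mathrm{d}\mu$ (weak gradient, for $\mu$ with the same null sets as Lebesgue measure; $+\infty$ if there is none), these three being $+\infty$ if $\nu\not\ll\mu$. -/

import Mathlib

open MeasureTheory ProbabilityTheory Filter Topology
open scoped ENNReal NNReal

namespace OUCutoff

/-! ### Ornstein-Uhlenbeck processes -/

/-- Standard Brownian motion in `ℝⁿ`, started at the origin: the coordinates are independent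
standard real Brownian motions. -/
structure IsStandardBrownian {n : ℕ} {Ω : Type*} [MeasurableSpace Ω]
    (B : ℝ≥0 → Ω → EuclideanSpace ℝ (Fin n)) (P : Measure Ω) : Prop where
  coord : ∀ i, IsBrownianReal (fun t ω => B t ω i) P
  indep : iIndepFun (fun (i : Fin n) (ω : Ω) (t : ℝ≥0) => B t ω i) P

/-- `Z` is a solution of the stochastic differential equation
`Z₀ = z`, `dZ_t = √(2/n) dB_t - Z_t dt` in `ℝⁿ`, for some standard `n`-dimensional Brownian
motion `B`. The noise is additive with a constant coefficient, so the stochastic integral of the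
coefficient is `√(2/n) B_t`, and the equation in integral form only involves a pathwise integral
of the continuous path `s ↦ Z_s`. -/
structure IsOrnsteinUhlenbeck {n : ℕ} {Ω : Type*} [MeasurableSpace Ω]
    (z : EuclideanSpace ℝ (Fin n)) (Z : ℝ≥0 → Ω → EuclideanSpace ℝ (Fin n))
    (P : Measure Ω) : Prop where
  aemeasurable : ∀ t, AEMeasurable (Z t) P
  continuous_paths : ∀ᵐ ω ∂P, Continuous (fun t => Z t ω)
  sde : ∃ B : ℝ≥0 → Ω → EuclideanSpace ℝ (Fin n), IsStandardBrownian B P ∧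
    ∀ᵐ ω ∂P, ∀ t : ℝ≥0,
      Z t ω = z + √(2 / (n : ℝ)) • B t ω - ∫ s in (0 : ℝ)..(t : ℝ), Z s.toNNReal ω

/-- The Gaussian law `𝒩(0, Iₙ / n)` on `ℝⁿ`, the invariant law of the process above. -/
noncomputable def equilibrium (n : ℕ) : Measure (EuclideanSpace ℝ (Fin n)) :=
  multivariateGaussian 0 ((1 / (n : ℝ)) • (1 : Matrix (Fin n) (Fin n) ℝ))

/-! ### Distances and divergences between probability measures on `ℝⁿ` -/

/-- The Wasserstein distance of order `2` for the Euclidean norm: an infimum over all couplings,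
that is, over all joint laws with the given marginals. -/
noncomputable def wasserstein {n : ℕ} (μ ν : Measure (EuclideanSpace ℝ (Fin n))) : ℝ≥0∞ :=
  (⨅ (γ : Measure (EuclideanSpace ℝ (Fin n) × EuclideanSpace ℝ (Fin n)))
    (_ : γ.map Prod.fst = μ ∧ γ.map Prod.snd = ν), ∫⁻ p, ‖p.1 - p.2‖ₑ ^ 2 ∂γ) ^ (1 / 2 : ℝ)

/-- The total variation distance `sup_A |μ(A) - ν(A)|` over Borel sets `A`. -/
noncomputable def totalVariation {n : ℕ} (μ ν : Measure (EuclideanSpace ℝ (Fin n))) : ℝ≥0∞ :=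
  ⨆ (A : Set (EuclideanSpace ℝ (Fin n))) (_ : MeasurableSet A),
    ENNReal.ofReal |μ.real A - ν.real A|

/-- The Hellinger distance `(∫ ½ (√f_μ - √f_ν)² dλ)^(1/2)`, where `f_μ` and `f_ν` are the densities
of `μ` and `ν` with respect to a dominating measure `λ`. The value does not depend on `λ`, here
`λ = μ + ν`. -/
noncomputable def hellinger {n : ℕ} (μ ν : Measure (EuclideanSpace ℝ (Fin n))) : ℝ≥0∞ :=
  (∫⁻ x, ENNReal.ofReal
    (1 / 2 * (√(μ.rnDeriv (μ + ν) x).toReal - √(ν.rnDeriv (μ + ν) x).toReal) ^ 2)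
      ∂(μ + ν)) ^ (1 / 2 : ℝ)

open Classical in
/-- The `χ²` divergence `∫ |dν/dμ - 1|² dμ`, infinite if `ν` is not absolutely continuous with
respect to `μ`. -/
noncomputable def chiSquare {n : ℕ} (ν μ : Measure (EuclideanSpace ℝ (Fin n))) : ℝ≥0∞ :=
  if ν ≪ μ then ∫⁻ x, ENNReal.ofReal (((ν.rnDeriv μ x).toReal - 1) ^ 2) ∂μ else ∞

/-- `g` is a weak gradient of `h` on `ℝⁿ`, in the sense of integration by parts against smooth
compactly supported test functions. -/
structure IsWeakGradient {n : ℕ} (h : EuclideanSpace ℝ (Fin n) → ℝ)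
    (g : EuclideanSpace ℝ (Fin n) → EuclideanSpace ℝ (Fin n)) : Prop where
  locallyIntegrable : LocallyIntegrable h volume
  locallyIntegrable_grad : LocallyIntegrable g volume
  integral_by_parts : ∀ φ : EuclideanSpace ℝ (Fin n) → ℝ, ContDiff ℝ (⊤ : ℕ∞) φ → HasCompactSupport φ →
    ∀ v : EuclideanSpace ℝ (Fin n),
      ∫ x, h x * fderiv ℝ φ x v = - ∫ x, inner ℝ (g x) v * φ x

open Classical in
/-- The Fisher information `4 ∫ |∇ √(dν/dμ)|² dμ` of `ν` with respect to a measure `μ` that has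
the same null sets as Lebesgue measure. The gradient is the weak one, which is unique up to null
sets, so that the infimum only serves to give the value `∞` when there is none. It is infinite
if `ν` is not absolutely continuous with respect to `μ`. -/
noncomputable def fisher {n : ℕ} (ν μ : Measure (EuclideanSpace ℝ (Fin n))) : ℝ≥0∞ :=
  if ν ≪ μ then
    ⨅ (g : EuclideanSpace ℝ (Fin n) → EuclideanSpace ℝ (Fin n))
      (_ : IsWeakGradient (fun x => √(ν.rnDeriv μ x).toReal) g), 4 * ∫⁻ x, ‖g x‖ₑ ^ 2 ∂μ
  else ∞

/-- The six distances or divergences. -/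
inductive Discrepancy where
  | wasserstein
  | totalVariation
  | hellinger
  | kullback
  | chiSquare
  | fisher

namespace Discrepancy

/-- The value `dist(μ ∣ ν)`. -/
noncomputable def eval {n : ℕ} (D : Discrepancy) (μ ν : Measure (EuclideanSpace ℝ (Fin n))) :
    ℝ≥0∞ :=
  match D with
  | wasserstein => OUCutoff.wasserstein μ ν
  | totalVariation => OUCutoff.totalVariation μ ν
  | hellinger => OUCutoff.hellinger μ ν
  | kullback => InformationTheory.klDiv μ ν
  | chiSquare => OUCutoff.chiSquare μ ν
  | fisher => OUCutoff.fisher μ ν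

/-- The maximal value of each distance or divergence. -/
noncomputable def max : Discrepancy → ℝ≥0∞
  | wasserstein => ∞
  | totalVariation => 1
  | hellinger => 1
  | kullback => ∞
  | chiSquare => ∞
  | fisher => ∞

/-- The critical time in dimension `n`. -/
noncomputable def cutoffTime (D : Discrepancy) (n : ℕ) : ℝ :=
  match D with
  | wasserstein => 1 / 2 * Real.log n
  | totalVariation => Real.log n
  | hellinger => Real.log n
  | kullback => Real.log n
  | chiSquare => Real.log n
  | fisher => 3 / 2 * Real.log n

end Discrepancy

end OUCutoff

/-! The equation is linear with additive noise, so its solution at time `t` is Gaussian: mean `exp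
(-t) z`, covariance `(1 - exp (-2t)) / n` times the identity (`IsOrnsteinUhlenbeck.map_eq`). This
follows from the pathwise identity `d(eˢ Z_s) = √(2/n) eˢ dB_s`, read through Riemann-Stieltjes
sums, so that no stochastic integral is needed.

At time `θ log n` the mean `m` has `‖m‖²` of order `n ^ (1 - 2θ)`, and the variance differs from its
equilibrium value `1/n` by the relative amount `q = n ^ (-2θ)`. The mean decides the cutoff. It
contributes `‖m‖²` to the squared Wasserstein distance, `n ‖m‖²` to the exponent of `χ²`, and `n²
‖m‖²` to the Fisher information. These have orders `n ^ (1 - 2θ)`, `n ^ (2 - 2θ)` and `n ^ (3 -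
2θ)`, whence the thresholds `1/2`, `1` and `3/2` for `θ`. The variance defect contributes only `(√(1
- q) - 1)²`, `n q²` and `n² q² / (1 - q)`, all vanishing above the respective thresholds.

Fisher and `χ²` are computed exactly (`fisher_isoGaussian`, `chiSquare_isoGaussian`). Wasserstein is
bounded above by an affine coupling and below by the distance between means. Above the threshold,
`χ²` controls total variation, Hellinger and Kullback. Below it, the half-space bisecting the
segment from `0` to `m` asymptotically separates the two laws (`IsOUScaling.separated`), and this
alone forces all four to their maximal values. -/

namespace OUCutoff

open scoped RealInnerProductSpace

section

variable {n : ℕ}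

/-! ### Isotropic Gaussian laws -/

/-- The Gaussian law `𝒩(m, s Iₙ)` on `ℝⁿ`. -/
noncomputable abbrev isoGaussian (m : EuclideanSpace ℝ (Fin n)) (s : ℝ) :
    Measure (EuclideanSpace ℝ (Fin n)) :=
  multivariateGaussian m (s • (1 : Matrix (Fin n) (Fin n) ℝ))

lemma posSemidef_smul_one {s : ℝ} (hs : 0 ≤ s) :
    (s • (1 : Matrix (Fin n) (Fin n) ℝ)).PosSemidef :=
  Matrix.PosSemidef.one.smul hs

lemma dotProduct_smul_one_mulVec (s : ℝ) (x y : EuclideanSpace ℝ (Fin n)) :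
    x.ofLp ⬝ᵥ (s • (1 : Matrix (Fin n) (Fin n) ℝ)).mulVec y.ofLp = s * ⟪x, y⟫ := by
  rw [Matrix.smul_mulVec, Matrix.one_mulVec, dotProduct_smul, smul_eq_mul,
    EuclideanSpace.inner_eq_star_dotProduct, dotProduct_comm]
  simp

lemma charFun_isoGaussian {s : ℝ} (hs : 0 ≤ s) (m u : EuclideanSpace ℝ (Fin n)) :
    charFun (isoGaussian m s) u =
      Complex.exp (⟪u, m⟫ * Complex.I - (s * ‖u‖ ^ 2 : ℝ) / 2) := by
  rw [charFun_multivariateGaussian (posSemidef_smul_one hs)]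
  congr 2
  have := dotProduct_smul_one_mulVec s u u
  rw [real_inner_self_eq_norm_sq] at this
  rw [← this]

/-- Provides the transport map behind the coupling in `wasserstein_affine_le`. -/
lemma map_affine_isoGaussian {s : ℝ} (hs : 0 ≤ s) (m : EuclideanSpace ℝ (Fin n)) (c : ℝ) :
    (isoGaussian 0 s).map (fun x => m + c • x) = isoGaussian m (c ^ 2 * s) := by
  have hmeas : Measurable fun x : EuclideanSpace ℝ (Fin n) => m + c • x := by fun_prop
  have := Measure.isProbabilityMeasure_map (μ := isoGaussian (n := n) 0 s) hmeas.aemeasurable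
  apply Measure.ext_of_charFun
  ext u
  have hcomp : (isoGaussian 0 s).map (fun x => m + c • x) =
      ((isoGaussian 0 s).map (fun x => c • x)).map (fun x => m + x) := by
    rw [Measure.map_map (by fun_prop) (by fun_prop)]; rfl
  rw [hcomp, charFun_map_const_add, charFun_map_smul, charFun_isoGaussian hs,
    charFun_isoGaussian (by positivity), ← Complex.exp_add, norm_smul, mul_pow]
  congr 1
  simp only [inner_zero_right, real_inner_comm, Real.norm_eq_abs, sq_abs]
  push_cast
  ring

/-- The density of `𝒩(m, s Iₙ)` with respect to the Lebesgue measure. -/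
noncomputable def gaussPdf (m : EuclideanSpace ℝ (Fin n)) (s : ℝ)
    (x : EuclideanSpace ℝ (Fin n)) : ℝ :=
  (2 * Real.pi * s) ^ (-(n / 2 : ℝ)) * Real.exp (-‖x - m‖ ^ 2 / (2 * s))

lemma gaussPdf_pos {s : ℝ} (hs : 0 < s) (m x : EuclideanSpace ℝ (Fin n)) :
    0 < gaussPdf m s x := by
  unfold gaussPdf; positivity

lemma continuous_gaussPdf (m : EuclideanSpace ℝ (Fin n)) (s : ℝ) : Continuous (gaussPdf m s) := by
  unfold gaussPdf; fun_prop

lemma integrable_exp_neg_mul_sq_norm_add_inner {b : ℝ} (hb : 0 < b)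
    (w : EuclideanSpace ℝ (Fin n)) :
    Integrable (fun v : EuclideanSpace ℝ (Fin n) => Real.exp (-b * ‖v‖ ^ 2 + ⟪w, v⟫)) := by
  have h := (GaussianFourier.integrable_cexp_neg_mul_sq_norm_add (b := (b : ℂ))
    (by simpa using hb) 1 w).re
  refine h.congr (ae_of_all _ fun v => ?_)
  have : (-(b : ℂ) * (‖v‖ : ℂ) ^ 2 + 1 * (⟪w, v⟫ : ℂ)) =
      ((-b * ‖v‖ ^ 2 + ⟪w, v⟫ : ℝ) : ℂ) := by push_cast; ring
  simp only [this, ← Complex.ofReal_exp]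
  exact Complex.ofReal_re _

lemma integral_exp_neg_mul_sq_norm_add_inner {b : ℝ} (hb : 0 < b)
    (w : EuclideanSpace ℝ (Fin n)) :
    ∫ v : EuclideanSpace ℝ (Fin n), Real.exp (-b * ‖v‖ ^ 2 + ⟪w, v⟫) =
      (Real.pi / b) ^ (n / 2 : ℝ) * Real.exp (‖w‖ ^ 2 / (4 * b)) := by
  have h := GaussianFourier.integral_cexp_neg_mul_sq_norm_add (b := (b : ℂ)) (by simpa using hb) 1 w
  have h1 : ∀ v : EuclideanSpace ℝ (Fin n),
      Complex.exp (-(b : ℂ) * (‖v‖ : ℂ) ^ 2 + 1 * (⟪w, v⟫ : ℂ)) =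
      (Real.exp (-b * ‖v‖ ^ 2 + ⟪w, v⟫) : ℂ) := by
    intro v; push_cast; ring_nf
  simp_rw [h1] at h
  rw [integral_complex_ofReal] at h
  apply Complex.ofReal_injective
  rw [h, Complex.ofReal_mul, Complex.ofReal_cpow (by positivity)]
  simp

lemma lintegral_gaussPdf {s : ℝ} (hs : 0 < s) (m : EuclideanSpace ℝ (Fin n)) :
    ∫⁻ x, ENNReal.ofReal (gaussPdf m s x) = 1 := by
  have hb : 0 < 1 / (2 * s) := by positivity
  rw [← lintegral_add_right_eq_self _ m]
  have h0 : ∀ x, gaussPdf m s (x + m) = (2 * Real.pi * s) ^ (-(n / 2 : ℝ)) *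
      Real.exp (-(1 / (2 * s)) * ‖x‖ ^ 2 + ⟪(0 : EuclideanSpace ℝ (Fin n)), x⟫) := by
    intro x
    simp only [gaussPdf, add_sub_cancel_right, inner_zero_left]
    congr 2; ring
  simp_rw [h0]
  rw [← ofReal_integral_eq_lintegral_ofReal
    ((integrable_exp_neg_mul_sq_norm_add_inner hb 0).const_mul _)
    (ae_of_all _ fun x => by positivity),
    integral_const_mul, integral_exp_neg_mul_sq_norm_add_inner hb]
  rw [show Real.pi / (1 / (2 * s)) = 2 * Real.pi * s by field_simp, ← mul_assoc,
    ← Real.rpow_add (by positivity)]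
  simp

/-- Both sides have the same characteristic function: after translation by `m`, the one on the right
is a complex Gaussian integral with linear coefficient `I`. -/
lemma isoGaussian_eq_withDensity {s : ℝ} (hs : 0 < s) (m : EuclideanSpace ℝ (Fin n)) :
    isoGaussian m s = volume.withDensity fun x => ENNReal.ofReal (gaussPdf m s x) := by
  have hb : 0 < 1 / (2 * s) := by positivity
  have : IsFiniteMeasure
      ((volume : Measure (EuclideanSpace ℝ (Fin n))).withDensity
        fun x => ENNReal.ofReal (gaussPdf m s x)) :=
    isFiniteMeasure_withDensity (by rw [lintegral_gaussPdf hs]; simp)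
  apply Measure.ext_of_charFun
  ext u
  rw [charFun_isoGaussian hs.le, charFun_apply, integral_withDensity_eq_integral_toReal_smul
    ((continuous_gaussPdf m s).measurable.ennreal_ofReal) (by simp)]
  simp_rw [ENNReal.toReal_ofReal (gaussPdf_pos hs _ _).le]
  rw [← integral_add_right_eq_self _ m]
  have h0 : ∀ x, gaussPdf m s (x + m) • Complex.exp (⟪x + m, u⟫ * Complex.I) =
      (((2 * Real.pi * s) ^ (-(n / 2 : ℝ)) : ℝ) * Complex.exp (⟪u, m⟫ * Complex.I)) *
      Complex.exp (-((1 / (2 * s) : ℝ) : ℂ) * (‖x‖ : ℂ) ^ 2 + Complex.I * (⟪u, x⟫ : ℂ)) := by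
    intro x
    simp only [gaussPdf, add_sub_cancel_right, Complex.real_smul]
    rw [Complex.ofReal_mul, Complex.ofReal_exp, mul_assoc, mul_assoc _ (Complex.exp _),
      ← Complex.exp_add, ← Complex.exp_add, inner_add_left, real_inner_comm u x,
      real_inner_comm u m]
    congr 2
    push_cast
    ring
  simp_rw [h0]
  rw [integral_const_mul, GaussianFourier.integral_cexp_neg_mul_sq_norm_add
    (by rw [Complex.ofReal_re]; exact hb)]
  have h1 : ((Real.pi : ℂ) / ((1 / (2 * s) : ℝ) : ℂ)) ^
      ((Module.finrank ℝ (EuclideanSpace ℝ (Fin n)) : ℂ) / 2) =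
      (((2 * Real.pi * s) ^ (n / 2 : ℝ) : ℝ) : ℂ) := by
    rw [Complex.ofReal_cpow (by positivity)]
    congr 1
    · push_cast
      rw [div_div_eq_mul_div]; ring
    · simp
  rw [h1, mul_mul_mul_comm, ← Complex.ofReal_mul, ← Real.rpow_add (by positivity), neg_add_cancel,
    Real.rpow_zero, ← Complex.exp_add]
  simp only [Complex.ofReal_one, one_mul]
  congr 1
  push_cast
  rw [Complex.I_sq]
  field_simp
  ring

/-- The density of `𝒩(m, s Iₙ)` with respect to `𝒩(0, τ Iₙ)`. -/
noncomputable def gaussRatio (m : EuclideanSpace ℝ (Fin n)) (s τ : ℝ)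
    (x : EuclideanSpace ℝ (Fin n)) : ℝ :=
  (τ / s) ^ (n / 2 : ℝ) * Real.exp (‖x‖ ^ 2 / (2 * τ) - ‖x - m‖ ^ 2 / (2 * s))

lemma gaussRatio_pos {s τ : ℝ} (hs : 0 < s) (hτ : 0 < τ) (m x : EuclideanSpace ℝ (Fin n)) :
    0 < gaussRatio m s τ x := by
  unfold gaussRatio; positivity

lemma continuous_gaussRatio (m : EuclideanSpace ℝ (Fin n)) (s τ : ℝ) :
    Continuous (gaussRatio m s τ) := by
  unfold gaussRatio; fun_prop

lemma gaussPdf_zero_mul_gaussRatio {s τ : ℝ} (hs : 0 < s) (hτ : 0 < τ)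
    (m x : EuclideanSpace ℝ (Fin n)) :
    gaussPdf 0 τ x * gaussRatio m s τ x = gaussPdf m s x := by
  unfold gaussPdf gaussRatio
  rw [mul_mul_mul_comm, ← Real.exp_add, Real.rpow_neg (by positivity),
    Real.rpow_neg (by positivity), ← Real.inv_rpow (by positivity), ← Real.inv_rpow (by positivity),
    ← Real.mul_rpow (by positivity) (by positivity)]
  congr 2
  · field_simp
  · simp; ring

lemma isoGaussian_eq_withDensity_isoGaussian {s τ : ℝ} (hs : 0 < s) (hτ : 0 < τ)
    (m : EuclideanSpace ℝ (Fin n)) :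
    isoGaussian m s =
      (isoGaussian 0 τ).withDensity fun x => ENNReal.ofReal (gaussRatio m s τ x) := by
  rw [isoGaussian_eq_withDensity hs, isoGaussian_eq_withDensity hτ, ← withDensity_mul _
    ((continuous_gaussPdf 0 τ).measurable.ennreal_ofReal)
    ((continuous_gaussRatio m s τ).measurable.ennreal_ofReal)]
  congr 1
  ext x
  rw [Pi.mul_apply, ← ENNReal.ofReal_mul (gaussPdf_pos hτ _ _).le,
    gaussPdf_zero_mul_gaussRatio hs hτ]

lemma isoGaussian_absolutelyContinuous {s τ : ℝ} (hs : 0 < s) (hτ : 0 < τ)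
    (m : EuclideanSpace ℝ (Fin n)) : isoGaussian m s ≪ isoGaussian 0 τ := by
  rw [isoGaussian_eq_withDensity_isoGaussian hs hτ]
  exact withDensity_absolutelyContinuous _ _

lemma isoGaussian_absolutelyContinuous_volume {s : ℝ} (hs : 0 < s)
    (m : EuclideanSpace ℝ (Fin n)) : isoGaussian m s ≪ volume := by
  rw [isoGaussian_eq_withDensity hs]
  exact withDensity_absolutelyContinuous _ _

lemma volume_absolutelyContinuous_isoGaussian {s : ℝ} (hs : 0 < s)
    (m : EuclideanSpace ℝ (Fin n)) : volume ≪ isoGaussian m s := by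
  rw [isoGaussian_eq_withDensity hs]
  exact withDensity_absolutelyContinuous'
    (continuous_gaussPdf m s).measurable.ennreal_ofReal.aemeasurable
    (ae_of_all _ fun x => by simpa using gaussPdf_pos hs m x)

lemma toReal_rnDeriv_isoGaussian {s τ : ℝ} (hs : 0 < s) (hτ : 0 < τ)
    (m : EuclideanSpace ℝ (Fin n)) :
    (fun x => ((isoGaussian m s).rnDeriv (isoGaussian 0 τ) x).toReal) =ᵐ[isoGaussian 0 τ]
      gaussRatio m s τ := by
  rw [isoGaussian_eq_withDensity_isoGaussian hs hτ]
  filter_upwards [Measure.rnDeriv_withDensity (isoGaussian 0 τ)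
    ((continuous_gaussRatio m s τ).measurable.ennreal_ofReal)] with x hx
  rw [hx, ENNReal.toReal_ofReal (gaussRatio_pos hs hτ m x).le]

/-! ### Moments -/

lemma integral_inner_isoGaussian (m v : EuclideanSpace ℝ (Fin n)) (s : ℝ) :
    ∫ x, ⟪v, x⟫ ∂(isoGaussian m s) = ⟪v, m⟫ := by
  rw [integral_inner (by exact IsGaussian.integrable_id), integral_id_multivariateGaussian]

lemma variance_inner_isoGaussian {s : ℝ} (hs : 0 ≤ s) (m v : EuclideanSpace ℝ (Fin n)) :
    Var[fun x => ⟪v, x⟫; isoGaussian m s] = s * ‖v‖ ^ 2 := by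
  rw [← covariance_self (by fun_prop), ← covarianceBilin_apply_eq_cov IsGaussian.memLp_two_id,
    covarianceBilin_multivariateGaussian (posSemidef_smul_one hs), dotProduct_smul_one_mulVec,
    real_inner_self_eq_norm_sq]

lemma memLp_two_isoGaussian (m : EuclideanSpace ℝ (Fin n)) (s : ℝ) :
    MemLp (fun x => x) 2 (isoGaussian m s) := IsGaussian.memLp_two_id

lemma integral_sq_norm_sub_isoGaussian {s : ℝ} (hs : 0 ≤ s) (m : EuclideanSpace ℝ (Fin n)) :
    ∫ x, ‖x - m‖ ^ 2 ∂(isoGaussian m s) = s * n := by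
  have hcoord : ∀ i : Fin n, MemLp (fun x : EuclideanSpace ℝ (Fin n) => x i - m i) 2
      (isoGaussian m s) := fun i =>
    (((EuclideanSpace.proj i : EuclideanSpace ℝ (Fin n) →L[ℝ] ℝ).comp_memLp'
      (memLp_two_isoGaussian m s))).sub (memLp_const (m i))
  simp_rw [EuclideanSpace.real_norm_sq_eq, PiLp.sub_apply]
  rw [integral_finsetSum _ fun i _ => (hcoord i).integrable_sq]
  have h : ∀ i : Fin n, ∫ x, (x i - m i) ^ 2 ∂(isoGaussian m s) = s := by
    intro i
    have hmean : ∫ x, x i ∂(isoGaussian m s) = m i := by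
      have := (EuclideanSpace.proj i : EuclideanSpace ℝ (Fin n) →L[ℝ] ℝ).integral_comp_comm
        (μ := isoGaussian m s) (φ := fun x => x) IsGaussian.integrable_id
      rw [integral_id_multivariateGaussian] at this
      exact this
    have hvar := variance_eval_multivariateGaussian (μ := m)
      (posSemidef_smul_one (n := n) hs) i
    rw [variance_eq_integral (by fun_prop), hmean] at hvar
    simpa using hvar
  simp [h, mul_comm]

/-- The cross term vanishes because `x - m` is centred. Serves both for the cost of the affine
coupling and for the Fisher information, whose score is affine. -/
lemma lintegral_enorm_sq_affine_isoGaussian {s : ℝ} (hs : 0 ≤ s)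
    (m w : EuclideanSpace ℝ (Fin n)) (a : ℝ) :
    ∫⁻ x, ‖w + a • (x - m)‖ₑ ^ 2 ∂(isoGaussian m s) =
      ENNReal.ofReal (‖w‖ ^ 2 + a ^ 2 * (s * n)) := by
  have hsub : MemLp (fun x => x - m) 2 (isoGaussian m s) :=
    (memLp_two_isoGaussian m s).sub (memLp_const m)
  have hpt : ∀ x : EuclideanSpace ℝ (Fin n), ‖w + a • (x - m)‖ ^ 2 =
      ‖w‖ ^ 2 + (2 * a) * ⟪w, x - m⟫ + a ^ 2 * ‖x - m‖ ^ 2 := by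
    intro x
    rw [norm_add_sq_real, inner_smul_right, norm_smul, mul_pow, Real.norm_eq_abs, sq_abs]
    ring
  have hint1 : Integrable (fun x => ⟪w, x - m⟫) (isoGaussian m s) :=
    (hsub.integrable (by norm_num)).const_inner w
  have hint2 : Integrable (fun x => ‖x - m‖ ^ 2) (isoGaussian m s) := hsub.norm.integrable_sq
  have hint : Integrable (fun x => ‖w + a • (x - m)‖ ^ 2) (isoGaussian m s) := by
    simp_rw [hpt]
    exact ((integrable_const _).add (hint1.const_mul _)).add (hint2.const_mul _)
  have h1 : ∀ x : EuclideanSpace ℝ (Fin n),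
      ‖w + a • (x - m)‖ₑ ^ 2 = ENNReal.ofReal (‖w + a • (x - m)‖ ^ 2) := by
    intro x
    rw [ENNReal.ofReal_pow (norm_nonneg _), ofReal_norm]
  simp_rw [h1]
  rw [← ofReal_integral_eq_lintegral_ofReal hint (ae_of_all _ fun x => by positivity)]
  congr 1
  simp_rw [hpt]
  rw [integral_add (by exact (integrable_const _).add (hint1.const_mul _)) (hint2.const_mul _),
    integral_add (integrable_const _) (hint1.const_mul _), integral_const_mul, integral_const_mul,
    integral_sq_norm_sub_isoGaussian hs,
    integral_inner (by exact hsub.integrable (by norm_num)),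
    integral_sub (by exact IsGaussian.integrable_id) (integrable_const _),
    integral_id_multivariateGaussian]
  simp

/-! ### Separation by a half-space -/

/-- Chebyshev for `⟪m, ·⟫`, which has variance `s ‖m‖²` and mean `‖m‖²` here, `0` for the centred
law; the threshold is halfway between the two means. -/
lemma isoGaussian_halfSpace_compl_le {s : ℝ} (hs : 0 ≤ s) {m : EuclideanSpace ℝ (Fin n)}
    (hm : m ≠ 0) :
    isoGaussian m s {x | ‖m‖ ^ 2 / 2 ≤ ⟪m, x⟫}ᶜ ≤ ENNReal.ofReal (4 * s / ‖m‖ ^ 2) := by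
  have hpos : 0 < ‖m‖ ^ 2 / 2 := by have := norm_pos_iff.2 hm; positivity
  have h := meas_ge_le_variance_div_sq (μ := isoGaussian m s) (X := fun x => ⟪m, x⟫)
    ((memLp_two_isoGaussian m s).const_inner m) hpos
  rw [integral_inner_isoGaussian, variance_inner_isoGaussian hs, real_inner_self_eq_norm_sq] at h
  refine (measure_mono ?_).trans (h.trans (ENNReal.ofReal_le_ofReal (le_of_eq ?_)))
  · intro x hx
    simp only [Set.mem_compl_iff, Set.mem_ofPred_eq, not_le] at hx ⊢
    rw [abs_sub_comm]
    exact le_trans (by linarith) (le_abs_self _)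
  · have := norm_pos_iff.2 hm
    field_simp
    norm_num

lemma isoGaussian_zero_halfSpace_le {s : ℝ} (hs : 0 ≤ s) {m : EuclideanSpace ℝ (Fin n)}
    (hm : m ≠ 0) :
    isoGaussian 0 s {x | ‖m‖ ^ 2 / 2 ≤ ⟪m, x⟫} ≤ ENNReal.ofReal (4 * s / ‖m‖ ^ 2) := by
  have hpos : 0 < ‖m‖ ^ 2 / 2 := by have := norm_pos_iff.2 hm; positivity
  have h := meas_ge_le_variance_div_sq (μ := isoGaussian 0 s) (X := fun x => ⟪m, x⟫)
    ((memLp_two_isoGaussian 0 s).const_inner m) hpos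
  rw [integral_inner_isoGaussian, variance_inner_isoGaussian hs, inner_zero_right] at h
  refine (measure_mono ?_).trans (h.trans (ENNReal.ofReal_le_ofReal (le_of_eq ?_)))
  · intro x hx
    simp only [Set.mem_ofPred_eq, sub_zero] at hx ⊢
    exact hx.trans (le_abs_self _)
  · have := norm_pos_iff.2 hm
    field_simp
    norm_num

/-! ### The `χ²` divergence between isotropic Gaussian laws -/

/-- Squared ratio times density is the exponential of a quadratic with leading coefficient `1 / (2τ)
- 1 / s`; it is negative, so that the integral is finite, exactly because `s < 2τ`. -/
lemma lintegral_sq_gaussRatio {s τ : ℝ} (hs : 0 < s) (hτ : 0 < τ) (hsτ : s < 2 * τ)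
    (m : EuclideanSpace ℝ (Fin n)) :
    ∫⁻ x, ENNReal.ofReal (gaussRatio m s τ x ^ 2) ∂(isoGaussian 0 τ) =
      ENNReal.ofReal ((τ ^ 2 / (s * (2 * τ - s))) ^ (n / 2 : ℝ) *
        Real.exp (‖m‖ ^ 2 / (2 * τ - s))) := by
  have h2 : 0 < 2 * τ - s := by linarith
  have hb : 0 < (2 * τ - s) / (2 * τ * s) := by positivity
  rw [isoGaussian_eq_withDensity hτ, lintegral_withDensity_eq_lintegral_mul _
    (continuous_gaussPdf 0 τ).measurable.ennreal_ofReal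
    (show Measurable fun x => ENNReal.ofReal (gaussRatio m s τ x ^ 2) from
      ((continuous_gaussRatio m s τ).pow 2).measurable.ennreal_ofReal)]
  have h0 : ∀ x, ((fun x => ENNReal.ofReal (gaussPdf 0 τ x)) *
      (fun x => ENNReal.ofReal (gaussRatio m s τ x ^ 2)) :
        EuclideanSpace ℝ (Fin n) → ℝ≥0∞) x =
      ENNReal.ofReal (((2 * Real.pi * τ)⁻¹ ^ (n / 2 : ℝ) * ((τ / s) ^ 2) ^ (n / 2 : ℝ) *
        Real.exp (-‖m‖ ^ 2 / s)) *
        Real.exp (-((2 * τ - s) / (2 * τ * s)) * ‖x‖ ^ 2 + ⟪(2 / s) • m, x⟫)) := by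
    intro x
    rw [Pi.mul_apply, ← ENNReal.ofReal_mul (gaussPdf_pos hτ _ _).le]
    congr 1
    unfold gaussPdf gaussRatio
    rw [mul_pow, mul_mul_mul_comm, mul_assoc _ (Real.exp _) (Real.exp _), ← Real.exp_nat_mul,
      ← Real.exp_add, ← Real.exp_add, Real.rpow_neg (by positivity),
      ← Real.inv_rpow (by positivity), ← Real.rpow_natCast ((τ / s) ^ (n / 2 : ℝ)),
      ← Real.rpow_natCast (τ / s), ← Real.rpow_mul (by positivity), ← Real.rpow_mul (by positivity),
      mul_comm (n / 2 : ℝ) ((2 : ℕ) : ℝ), sub_zero, norm_sub_sq_real, inner_smul_left,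
      real_inner_comm x m]
    congr 2
    simp only [conj_trivial]
    push_cast
    field_simp
    ring
  simp_rw [h0]
  rw [← ofReal_integral_eq_lintegral_ofReal
    ((integrable_exp_neg_mul_sq_norm_add_inner hb _).const_mul _)
    (ae_of_all _ fun x => by positivity), integral_const_mul,
    integral_exp_neg_mul_sq_norm_add_inner hb]
  congr 1
  rw [mul_mul_mul_comm, ← Real.exp_add, ← Real.mul_rpow (by positivity) (by positivity),
    ← Real.mul_rpow (by positivity) (by positivity)]
  congr 2
  · field_simp
  · rw [norm_smul, Real.norm_eq_abs, mul_pow, sq_abs]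
    field_simp
    ring

end

section

variable {n : ℕ}

/-! ### Comparisons between divergences -/

lemma lintegral_enorm_le_rpow_half {α : Type*} [MeasurableSpace α] {E : Type*}
    [NormedAddCommGroup E] {μ : Measure α} [IsProbabilityMeasure μ] {f : α → E}
    (hf : AEStronglyMeasurable f μ) :
    ∫⁻ x, ‖f x‖ₑ ∂μ ≤ (∫⁻ x, ‖f x‖ₑ ^ 2 ∂μ) ^ (1 / 2 : ℝ) := by
  have h := eLpNorm_le_eLpNorm_of_exponent_le (p := 1) (q := 2) (by norm_num) hf
  rw [eLpNorm_one_eq_lintegral_enorm,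
    eLpNorm_eq_lintegral_rpow_enorm_toReal (by norm_num) (by norm_num)] at h
  simpa using h

lemma totalVariation_le_one (ν μ : Measure (EuclideanSpace ℝ (Fin n))) [IsProbabilityMeasure ν]
    [IsProbabilityMeasure μ] : totalVariation ν μ ≤ 1 := by
  refine iSup₂_le fun A _ => ?_
  rw [← ENNReal.ofReal_one]
  refine ENNReal.ofReal_le_ofReal (abs_sub_le_iff.2 ⟨?_, ?_⟩)
  · linarith [measureReal_le_one (μ := ν) (s := A), measureReal_nonneg (μ := μ) (s := A)]
  · linarith [measureReal_le_one (μ := μ) (s := A), measureReal_nonneg (μ := ν) (s := A)]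

/-- With `f` the density, `ν A - μ A` is the integral of `f - 1` over `A`; conclude by comparing the
`L¹` and `L²` norms under `μ`. -/
lemma totalVariation_le_sqrt_chiSquare (ν μ : Measure (EuclideanSpace ℝ (Fin n)))
    [IsProbabilityMeasure ν] [IsProbabilityMeasure μ] :
    totalVariation ν μ ≤ chiSquare ν μ ^ (1 / 2 : ℝ) := by
  unfold chiSquare
  split_ifs with hac
  swap
  · simp
  have hint : Integrable (fun x => (ν.rnDeriv μ x).toReal - 1) μ :=
    Measure.integrable_toReal_rnDeriv.sub (integrable_const 1)
  refine iSup₂_le fun A _ => ?_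
  have h1 : ν.real A - μ.real A = ∫ x in A, ((ν.rnDeriv μ x).toReal - 1) ∂μ := by
    rw [integral_sub Measure.integrable_toReal_rnDeriv.integrableOn (integrable_const 1),
      Measure.setIntegral_toReal_rnDeriv hac]
    simp
  calc ENNReal.ofReal |ν.real A - μ.real A|
      = ‖∫ x in A, ((ν.rnDeriv μ x).toReal - 1) ∂μ‖ₑ := by
        rw [h1, ← Real.norm_eq_abs, ofReal_norm]
    _ ≤ ∫⁻ x in A, ‖(ν.rnDeriv μ x).toReal - 1‖ₑ ∂μ := enorm_integral_le_lintegral_enorm _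
    _ ≤ ∫⁻ x, ‖(ν.rnDeriv μ x).toReal - 1‖ₑ ∂μ := setLIntegral_le_lintegral _ _
    _ ≤ _ := lintegral_enorm_le_rpow_half hint.aestronglyMeasurable
    _ = _ := by
        congr 2
        ext x
        rw [← ofReal_norm, ← ENNReal.ofReal_pow (norm_nonneg _), Real.norm_eq_abs, sq_abs]

/-- Pointwise, `log y ≤ y - 1` gives `y log y + 1 - y ≤ (y - 1)²`. -/
lemma klDiv_le_chiSquare (ν μ : Measure (EuclideanSpace ℝ (Fin n)))
    [IsProbabilityMeasure ν] [IsProbabilityMeasure μ] :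
    InformationTheory.klDiv ν μ ≤ chiSquare ν μ := by
  rw [InformationTheory.klDiv_eq_lintegral_klFun, chiSquare]
  split_ifs with hac
  · refine lintegral_mono fun x => ENNReal.ofReal_le_ofReal ?_
    rw [InformationTheory.klFun]
    set y := (ν.rnDeriv μ x).toReal
    have hy : 0 ≤ y := ENNReal.toReal_nonneg
    rcases hy.eq_or_lt with h0 | h0
    · simp [← h0]
    · have h := mul_le_mul_of_nonneg_left (Real.log_le_sub_one_of_pos h0) hy
      nlinarith
  · exact le_rfl

/-- The integrand of the squared Hellinger distance, for the densities with respect to `ν + μ`. -/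
noncomputable def hellingerIntegrand (ν μ : Measure (EuclideanSpace ℝ (Fin n)))
    (x : EuclideanSpace ℝ (Fin n)) : ℝ :=
  1 / 2 * (√(ν.rnDeriv (ν + μ) x).toReal - √(μ.rnDeriv (ν + μ) x).toReal) ^ 2

lemma sq_sqrt_sub_sqrt_le_abs {a b : ℝ} (ha : 0 ≤ a) (hb : 0 ≤ b) :
    (√a - √b) ^ 2 ≤ |a - b| := by
  have h1 : a - b = (√a - √b) * (√a + √b) := by
    ring_nf; rw [Real.sq_sqrt ha, Real.sq_sqrt hb]
  rw [h1, abs_mul, abs_of_nonneg (add_nonneg (Real.sqrt_nonneg a) (Real.sqrt_nonneg b)),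
    ← sq_abs, sq]
  refine mul_le_mul_of_nonneg_left (abs_le.2 ⟨?_, ?_⟩) (abs_nonneg _) <;>
    linarith [Real.sqrt_nonneg a, Real.sqrt_nonneg b]

section Hellinger

variable (ν μ : Measure (EuclideanSpace ℝ (Fin n))) [IsProbabilityMeasure ν]
  [IsProbabilityMeasure μ]

lemma integrable_hellingerIntegrand : Integrable (hellingerIntegrand ν μ) (ν + μ) := by
  have hi : Integrable (fun x => 1 / 2 * |(ν.rnDeriv (ν + μ) x).toReal -
      (μ.rnDeriv (ν + μ) x).toReal|) (ν + μ) :=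
    (Measure.integrable_toReal_rnDeriv.sub Measure.integrable_toReal_rnDeriv).abs.const_mul _
  refine hi.mono' ?_ (ae_of_all _ fun x => ?_)
  · unfold hellingerIntegrand
    exact Measurable.aestronglyMeasurable (by fun_prop)
  · unfold hellingerIntegrand
    rw [Real.norm_of_nonneg (by positivity)]
    have := sq_sqrt_sub_sqrt_le_abs (a := (ν.rnDeriv (ν + μ) x).toReal)
      (b := (μ.rnDeriv (ν + μ) x).toReal) ENNReal.toReal_nonneg ENNReal.toReal_nonneg
    linarith

lemma hellinger_eq :
    hellinger ν μ = ENNReal.ofReal (∫ x, hellingerIntegrand ν μ x ∂(ν + μ)) ^ (1 / 2 : ℝ) := by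
  rw [ofReal_integral_eq_lintegral_ofReal (integrable_hellingerIntegrand ν μ)
    (ae_of_all _ fun x => by unfold hellingerIntegrand; positivity)]
  rfl

lemma setIntegral_rnDeriv_add_left (A : Set (EuclideanSpace ℝ (Fin n))) :
    ∫ x in A, (ν.rnDeriv (ν + μ) x).toReal ∂(ν + μ) = ν.real A :=
  Measure.setIntegral_toReal_rnDeriv (Measure.AbsolutelyContinuous.rfl.add_right μ) A

lemma setIntegral_rnDeriv_add_right (A : Set (EuclideanSpace ℝ (Fin n))) :
    ∫ x in A, (μ.rnDeriv (ν + μ) x).toReal ∂(ν + μ) = μ.real A :=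
  Measure.setIntegral_toReal_rnDeriv
    (by rw [add_comm]; exact Measure.AbsolutelyContinuous.rfl.add_right ν) A

lemma setIntegral_linear_rnDeriv_add (A : Set (EuclideanSpace ℝ (Fin n))) (p q : ℝ) :
    ∫ x in A, (p * (ν.rnDeriv (ν + μ) x).toReal + q * (μ.rnDeriv (ν + μ) x).toReal) ∂(ν + μ) =
      p * ν.real A + q * μ.real A := by
  rw [integral_add (Measure.integrable_toReal_rnDeriv.const_mul p).integrableOn
    (Measure.integrable_toReal_rnDeriv.const_mul q).integrableOn, integral_const_mul,
    integral_const_mul, setIntegral_rnDeriv_add_left, setIntegral_rnDeriv_add_right]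

lemma abs_measureReal_sub_le_totalVariation {A : Set (EuclideanSpace ℝ (Fin n))}
    (hA : MeasurableSet A) : |ν.real A - μ.real A| ≤ (totalVariation ν μ).toReal := by
  have hfin : totalVariation ν μ ≠ ∞ := ((totalVariation_le_one ν μ).trans_lt (by simp)).ne
  refine (ENNReal.ofReal_le_iff_le_toReal hfin).1 ?_
  exact le_iSup₂_of_le (f := fun (A : Set (EuclideanSpace ℝ (Fin n))) (_ : MeasurableSet A) =>
    ENNReal.ofReal |ν.real A - μ.real A|) A hA le_rfl

/-- The integrand is at most `|a - b| / 2`, for `a`, `b` the two densities. On `{b ≤ a}` and on its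
complement, `|a - b|` integrates to a difference of probabilities, each at most the total variation.
-/
lemma hellinger_le_sqrt_totalVariation : hellinger ν μ ≤ totalVariation ν μ ^ (1 / 2 : ℝ) := by
  rw [hellinger_eq]
  refine ENNReal.rpow_le_rpow (ENNReal.ofReal_le_of_le_toReal ?_) (by norm_num)
  set a := fun x => (ν.rnDeriv (ν + μ) x).toReal with ha
  set b := fun x => (μ.rnDeriv (ν + μ) x).toReal with hb
  have hia : Integrable a (ν + μ) := Measure.integrable_toReal_rnDeriv
  have hib : Integrable b (ν + μ) := Measure.integrable_toReal_rnDeriv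
  have hA : MeasurableSet {x | b x ≤ a x} := measurableSet_le (by fun_prop) (by fun_prop)
  set A := {x | b x ≤ a x} with hAdef
  have h1 : ∫ x, hellingerIntegrand ν μ x ∂(ν + μ) ≤ ∫ x, 1 / 2 * |a x - b x| ∂(ν + μ) := by
    refine integral_mono (integrable_hellingerIntegrand ν μ) ((hia.sub hib).abs.const_mul _)
      fun x => ?_
    have := sq_sqrt_sub_sqrt_le_abs (a := a x) (b := b x) ENNReal.toReal_nonneg
      ENNReal.toReal_nonneg
    simp only [hellingerIntegrand]
    linarith
  have h2 : ∫ x in A, |a x - b x| ∂(ν + μ) = ν.real A - μ.real A := by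
    rw [setIntegral_congr_fun (g := fun x => a x - b x) hA
      fun x hx => abs_of_nonneg (sub_nonneg.2 hx), integral_sub hia.integrableOn hib.integrableOn,
      setIntegral_rnDeriv_add_left, setIntegral_rnDeriv_add_right]
  have h3 : ∫ x in Aᶜ, |a x - b x| ∂(ν + μ) = μ.real Aᶜ - ν.real Aᶜ := by
    rw [setIntegral_congr_fun (g := fun x => b x - a x) hA.compl
      fun x hx => (abs_of_nonpos (sub_nonpos.2 (not_le.1 (show ¬ b x ≤ a x from hx)).le)).trans
        (neg_sub _ _),
      integral_sub hib.integrableOn hia.integrableOn,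
      setIntegral_rnDeriv_add_left, setIntegral_rnDeriv_add_right]
  have h0 := integral_add_compl hA (hia.sub hib).abs
  simp only [Pi.sub_apply] at h0
  rw [integral_const_mul, ← h0] at h1
  have h4 := (le_abs_self _).trans (abs_measureReal_sub_le_totalVariation ν μ hA)
  have h5 := (neg_le_abs _).trans (abs_measureReal_sub_le_totalVariation ν μ hA.compl)
  rw [h2, h3] at h1
  linarith

lemma hellinger_le_one : hellinger ν μ ≤ 1 :=
  (hellinger_le_sqrt_totalVariation ν μ).trans
    ((ENNReal.rpow_le_rpow (totalVariation_le_one ν μ) (by norm_num)).trans (by simp))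

/-! ### Lower bounds from a separating set -/

omit [IsProbabilityMeasure μ] in
lemma one_sub_le_totalVariation {A : Set (EuclideanSpace ℝ (Fin n))} (hA : MeasurableSet A) :
    ENNReal.ofReal (1 - ν.real Aᶜ - μ.real A) ≤ totalVariation ν μ := by
  refine le_iSup₂_of_le A hA (ENNReal.ofReal_le_ofReal ?_)
  rw [probReal_compl_eq_one_sub hA]
  refine le_trans (le_of_eq ?_) (le_abs_self _)
  ring

/-- Weighted AM-GM, `√(ab) ≤ (k a + b / k) / 2`, bounds the affinity of the two laws. The small
weight `k = κ` is put on `A`, where `ν` concentrates, and `k = κ⁻¹` on `Aᶜ`, where `μ` does. -/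
lemma one_sub_le_hellinger {A : Set (EuclideanSpace ℝ (Fin n))} (hA : MeasurableSet A)
    {κ : ℝ} (hκ : 0 < κ) :
    ENNReal.ofReal (1 - κ - (μ.real A + ν.real Aᶜ) / (2 * κ)) ^ (1 / 2 : ℝ) ≤ hellinger ν μ := by
  rw [hellinger_eq]
  refine ENNReal.rpow_le_rpow (ENNReal.ofReal_le_ofReal ?_) (by norm_num)
  set a := fun x => (ν.rnDeriv (ν + μ) x).toReal with ha
  set b := fun x => (μ.rnDeriv (ν + μ) x).toReal with hb
  have hia : Integrable a (ν + μ) := Measure.integrable_toReal_rnDeriv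
  have hib : Integrable b (ν + μ) := Measure.integrable_toReal_rnDeriv
  have hF := integrable_hellingerIntegrand ν μ
  have hle : ∀ x (k : ℝ), 0 < k →
      (1 / 2 - k / 2) * a x + (1 / 2 - 1 / (2 * k)) * b x ≤ hellingerIntegrand ν μ x := by
    intro x k hk
    have h1 := Real.sq_sqrt (ENNReal.toReal_nonneg : 0 ≤ a x)
    have h2 := Real.sq_sqrt (ENNReal.toReal_nonneg : 0 ≤ b x)
    have h3 : 0 ≤ (k * √(a x) - √(b x)) ^ 2 / (2 * k) := by positivity
    refine sub_nonneg.1 (h3.trans (le_of_eq ?_))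
    change _ = 1 / 2 * (√(a x) - √(b x)) ^ 2 - _
    field_simp
    change √(a x) ^ 2 = a x at h1
    change √(b x) ^ 2 = b x at h2
    linear_combination (k ^ 2 - k) * h1 + (1 - k) * h2
  have h1 : (1 / 2 - κ / 2) * ν.real A + (1 / 2 - 1 / (2 * κ)) * μ.real A ≤
      ∫ x in A, hellingerIntegrand ν μ x ∂(ν + μ) := by
    rw [← setIntegral_linear_rnDeriv_add]
    exact integral_mono ((hia.const_mul _).add (hib.const_mul _)).integrableOn hF.integrableOn
      fun x => hle x κ hκ
  have h2 : (1 / 2 - κ⁻¹ / 2) * ν.real Aᶜ + (1 / 2 - 1 / (2 * κ⁻¹)) * μ.real Aᶜ ≤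
      ∫ x in Aᶜ, hellingerIntegrand ν μ x ∂(ν + μ) := by
    rw [← setIntegral_linear_rnDeriv_add]
    exact integral_mono ((hia.const_mul _).add (hib.const_mul _)).integrableOn hF.integrableOn
      fun x => hle x κ⁻¹ (inv_pos.2 hκ)
  rw [← integral_add_compl hA hF]
  refine le_trans ?_ (add_le_add h1 h2)
  have f1 : ν.real A = 1 - ν.real Aᶜ := by rw [probReal_compl_eq_one_sub hA]; ring
  have f2 : μ.real Aᶜ = 1 - μ.real A := probReal_compl_eq_one_sub hA
  have g1 : 0 ≤ κ * ν.real Aᶜ := by positivity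
  have g2 : 0 ≤ κ * μ.real A := by positivity
  rw [f1, f2]
  refine sub_nonneg.1 (le_trans (b := κ / 2 * ν.real Aᶜ + κ / 2 * μ.real A) (by linarith)
    (le_of_eq ?_))
  field_simp
  ring

/-- Variational bound for the entropy with test function `h 1_A`: integrate Young's inequality `h y
≤ (y log y + 1 - y) + (exp h - 1)` over `A`. -/
lemma ofReal_mul_le_klDiv_add (A : Set (EuclideanSpace ℝ (Fin n))) {h : ℝ}
    (hh : 0 ≤ h) :
    ENNReal.ofReal h * ν A ≤
      InformationTheory.klDiv ν μ + ENNReal.ofReal (Real.exp h - 1) * μ A := by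
  rw [InformationTheory.klDiv_eq_lintegral_klFun]
  split_ifs with hac
  swap
  · simp
  have := Measure.haveLebesgueDecomposition_of_sigmaFinite ν μ
  have hνA : ∫⁻ x in A, ν.rnDeriv μ x ∂μ = ν A := Measure.setLIntegral_rnDeriv hac A
  rw [← hνA, ← lintegral_const_mul _ (by fun_prop),
    ← setLIntegral_const]
  refine le_trans ?_ (add_le_add_left (setLIntegral_le_lintegral A _) _)
  rw [← lintegral_add_right _ measurable_const]
  refine lintegral_mono_ae ?_
  filter_upwards [ae_restrict_of_ae (Measure.rnDeriv_ne_top ν μ)] with x hx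
  have hexp : 0 ≤ Real.exp h - 1 := by have := Real.add_one_le_exp h; linarith
  rw [← ENNReal.ofReal_toReal hx, ← ENNReal.ofReal_mul hh, ENNReal.toReal_ofReal (by simp),
    ← ENNReal.ofReal_add (InformationTheory.klFun_nonneg (by simp)) hexp]
  refine ENNReal.ofReal_le_ofReal ?_
  rw [InformationTheory.klFun]
  have hy : 0 ≤ (ν.rnDeriv μ x).toReal := ENNReal.toReal_nonneg
  generalize (ν.rnDeriv μ x).toReal = y at hy
  rcases hy.eq_or_lt with h0 | h0
  · simp [← h0, (Real.exp_pos h).le]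
  -- Young's inequality is the tangent line bound for `exp` at `h - log y`, multiplied by `y`.
  · have h1 := Real.add_one_le_exp (h - Real.log y)
    rw [Real.exp_sub, Real.exp_log h0, le_div_iff₀ h0] at h1
    linarith

end Hellinger

/-! ### Wasserstein distance -/

lemma wasserstein_affine_le {τ : ℝ} (hτ : 0 ≤ τ) (m : EuclideanSpace ℝ (Fin n)) (c : ℝ) :
    wasserstein (isoGaussian m (c ^ 2 * τ)) (isoGaussian 0 τ) ≤
      ENNReal.ofReal (‖m‖ ^ 2 + (c - 1) ^ 2 * (τ * n)) ^ (1 / 2 : ℝ) := by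
  refine ENNReal.rpow_le_rpow ?_ (by norm_num)
  have hmeas : Measurable fun x : EuclideanSpace ℝ (Fin n) => (m + c • x, x) := by fun_prop
  refine iInf₂_le_of_le ((isoGaussian 0 τ).map fun x => (m + c • x, x)) ⟨?_, ?_⟩ ?_
  · rw [Measure.map_map measurable_fst hmeas, ← map_affine_isoGaussian hτ]
    rfl
  · rw [Measure.map_map measurable_snd hmeas]
    exact Measure.map_id
  · rw [lintegral_map (by fun_prop) hmeas, ← lintegral_enorm_sq_affine_isoGaussian hτ 0 m (c - 1)]
    refine lintegral_mono fun x => le_of_eq ?_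
    simp only [sub_zero]
    congr 2
    module

/-- Under any coupling the difference of means is the mean displacement, so Jensen's inequality
bounds its norm by the root of the cost. -/
lemma enorm_mean_le_wasserstein {ν μ : Measure (EuclideanSpace ℝ (Fin n))}
    [IsProbabilityMeasure ν] (hν : Integrable (fun x => x) ν) (hμ : Integrable (fun x => x) μ) :
    ‖∫ x, x ∂ν - ∫ x, x ∂μ‖ₑ ≤ wasserstein ν μ := by
  have hsq : ∀ c : ℝ≥0∞, c = (c ^ 2) ^ (1 / 2 : ℝ) := fun c => by
    rw [← ENNReal.rpow_natCast, ← ENNReal.rpow_mul]; norm_num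
  rw [hsq ‖_‖ₑ]
  refine ENNReal.rpow_le_rpow (le_iInf₂ fun γ hγ => ?_) (by norm_num)
  obtain ⟨h1, h2⟩ := hγ
  have : IsProbabilityMeasure (γ.map Prod.fst) := h1 ▸ inferInstance
  have : IsProbabilityMeasure γ :=
    (Measure.isProbabilityMeasure_map_iff measurable_fst.aemeasurable).1 this
  have i1 : Integrable (fun p => p.1) γ := by
    rw [← h1] at hν
    exact hν.comp_measurable measurable_fst
  have i2 : Integrable (fun p => p.2) γ := by
    rw [← h2] at hμ
    exact hμ.comp_measurable measurable_snd
  have e : ∫ x, x ∂ν - ∫ x, x ∂μ = ∫ p, (p.1 - p.2) ∂γ := by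
    rw [integral_sub i1 i2, ← h1, ← h2, integral_map (by fun_prop) (by fun_prop),
      integral_map (by fun_prop) (by fun_prop)]
  have h := (enorm_integral_le_lintegral_enorm (μ := γ) fun p => p.1 - p.2).trans
    (lintegral_enorm_le_rpow_half (i1.sub i2).aestronglyMeasurable)
  rw [← e] at h
  refine (pow_le_pow_left' h 2).trans (le_of_eq ?_)
  rw [← ENNReal.rpow_natCast, ← ENNReal.rpow_mul]
  norm_num

end

section

variable {n : ℕ}

/-! ### The law of the Ornstein-Uhlenbeck process -/

/-- A Riemann-Stieltjes sum of `∫₀ᵗ eˢ db_s` over the uniform subdivision of `[0, t]` in `m`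
steps. -/
noncomputable def expSum {E : Type*} [AddCommGroup E] [Module ℝ E]
    (b : ℝ → E) (t : ℝ) (m : ℕ) : E :=
  ∑ k ∈ Finset.range m, Real.exp (k * (t / m)) • (b ((k + 1 : ℕ) * (t / m)) - b (k * (t / m)))

lemma norm_linear_step_le {E : Type*} [NormedAddCommGroup E] [NormedSpace ℝ E] [CompleteSpace E]
    {f : ℝ → E} (hf : Continuous f) {a h K δ : ℝ} (h0 : 0 ≤ h) (h1 : h ≤ 1)
    (hK : ‖f (a + h)‖ ≤ K) (hδ : ∀ s ∈ Set.Icc a (a + h), ‖f (a + h) - f s‖ ≤ δ) :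
    ‖(Real.exp h - 1) • f (a + h) - ∫ s in a..a + h, f s‖ ≤ h ^ 2 * K + h * δ := by
  -- The first term is of second order since `|exp h - 1 - h| ≤ h²` for `h ≤ 1`; the second is
  -- controlled by the oscillation of `f`.
  have e : (Real.exp h - 1) • f (a + h) - ∫ s in a..a + h, f s =
      (Real.exp h - 1 - h) • f (a + h) + ∫ s in a..a + h, (f (a + h) - f s) := by
    rw [intervalIntegral.integral_sub (by simp) (hf.intervalIntegrable _ _),
      intervalIntegral.integral_const]
    simp only [add_sub_cancel_left]
    module
  rw [e]
  refine (norm_add_le _ _).trans (add_le_add ?_ ?_)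
  · rw [norm_smul]
    have := Real.norm_exp_sub_one_sub_id_le (x := h) (by rwa [Real.norm_of_nonneg h0])
    rw [Real.norm_of_nonneg h0] at this
    exact mul_le_mul this hK (norm_nonneg _) (by positivity)
  · refine (intervalIntegral.norm_integral_le_of_norm_le_const (C := δ) fun s hs => ?_).trans
      (le_of_eq ?_)
    · rw [Set.uIoc_of_le (by linarith)] at hs
      exact hδ s ⟨hs.1.le, hs.2⟩
    · rw [add_sub_cancel_left, abs_of_nonneg h0, mul_comm]

/-- Deterministic integration by parts. Telescope `eˢ f s` over the subdivision and eliminate the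
increments of `b` by the equation: each step leaves an error of at most `exp t * (h² K + h δ)`,
where `h` is the mesh, `K` bounds `f`, and `δ` bounds its oscillation. There are `t / h` steps. -/
lemma tendsto_expSum {E : Type*} [NormedAddCommGroup E] [NormedSpace ℝ E] [CompleteSpace E]
    {f b : ℝ → E} {z : E} {σ t : ℝ} (hf : Continuous f) (ht : 0 ≤ t)
    (hsde : ∀ s, 0 ≤ s → f s = z + σ • b s - ∫ r in (0 : ℝ)..s, f r) :
    Tendsto (fun m : ℕ => σ • expSum b t m) atTop (𝓝 (Real.exp t • f t - f 0)) := by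
  obtain ⟨K, hK⟩ := (isCompact_Icc (a := 0) (b := t)).exists_bound_of_continuousOn hf.continuousOn
  have hK0 : 0 ≤ K := (norm_nonneg _).trans (hK 0 ⟨le_rfl, ht⟩)
  have huc := (isCompact_Icc (a := 0) (b := t)).uniformContinuousOn_of_continuous hf.continuousOn
  rw [Metric.uniformContinuousOn_iff_le] at huc
  have hkey : ∀ (δ : ℝ), 0 < δ → ∀ᶠ m : ℕ in atTop,
      ‖(Real.exp t • f t - f 0) - σ • expSum b t m‖ ≤
        Real.exp t * (t / m * (t * K)) + Real.exp t * (t * δ) := by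
    intro δ hδ
    obtain ⟨η, hη, hmod⟩ := huc δ hδ
    have hsmall : Tendsto (fun m : ℕ => t / m) atTop (𝓝 0) :=
      tendsto_const_div_atTop_nhds_zero_nat t
    filter_upwards [hsmall.eventually_le_const hη, hsmall.eventually_le_const one_pos,
      eventually_gt_atTop 0] with m hm1 hm2 hm0
    have hm0' : (0 : ℝ) < m := by exact_mod_cast hm0
    set h := t / m with hh
    have hh0 : 0 ≤ h := by positivity
    have hmh : m * h = t := by rw [hh]; field_simp
    have htel : Real.exp t • f t - f 0 = ∑ k ∈ Finset.range m,
        (Real.exp ((k + 1 : ℕ) * h) • f ((k + 1 : ℕ) * h) - Real.exp (k * h) • f (k * h)) := by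
      rw [Finset.sum_range_sub (fun k : ℕ => Real.exp (k * h) • f (k * h)), hmh]
      simp
    rw [htel, expSum, ← hh, Finset.smul_sum, ← Finset.sum_sub_distrib]
    have hterm : ∀ k ∈ Finset.range m,
        ‖Real.exp ((k + 1 : ℕ) * h) • f ((k + 1 : ℕ) * h) - Real.exp (k * h) • f (k * h) -
          σ • Real.exp (k * h) • (b ((k + 1 : ℕ) * h) - b (k * h))‖ ≤
          Real.exp t * (h ^ 2 * K + h * δ) := by
      intro k hk
      have hk1 : ((k + 1 : ℕ) : ℝ) ≤ m := by exact_mod_cast Finset.mem_range.1 hk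
      set a := (k : ℝ) * h with ha
      have ha0 : 0 ≤ a := by positivity
      have hak : ((k + 1 : ℕ) : ℝ) * h = a + h := by push_cast; ring
      have hat : a + h ≤ t := by
        rw [← hak, ← hmh]; exact mul_le_mul_of_nonneg_right hk1 hh0
      have hadj : ∫ r in (0 : ℝ)..(a + h), f r =
          (∫ r in (0 : ℝ)..a, f r) + ∫ r in a..(a + h), f r :=
        (intervalIntegral.integral_add_adjacent_intervals (hf.intervalIntegrable _ _)
          (hf.intervalIntegrable _ _)).symm
      have hb : σ • (b (a + h) - b a) = f (a + h) - f a + ∫ r in a..(a + h), f r := by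
        rw [hsde a ha0, hsde (a + h) (by linarith), hadj]
        module
      rw [hak, smul_comm σ, hb]
      have e : Real.exp (a + h) • f (a + h) - Real.exp a • f a -
          Real.exp a • (f (a + h) - f a + ∫ r in a..(a + h), f r) =
          Real.exp a • ((Real.exp h - 1) • f (a + h) - ∫ r in a..(a + h), f r) := by
        rw [Real.exp_add]
        module
      rw [e, norm_smul, Real.norm_of_nonneg (Real.exp_pos a).le]
      refine mul_le_mul (Real.exp_le_exp.2 (by linarith)) ?_ (norm_nonneg _) (Real.exp_pos t).le
      refine norm_linear_step_le hf hh0 hm2 (hK _ ⟨by linarith, hat⟩) fun s hs => ?_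
      rw [← dist_eq_norm]
      refine hmod _ ⟨by linarith, hat⟩ _ ⟨ha0.trans hs.1, hs.2.trans hat⟩ ?_
      rw [Real.dist_eq, abs_of_nonneg (by linarith [hs.2])]
      linarith [hs.1]
    refine (norm_sum_le_of_le _ hterm).trans (le_of_eq ?_)
    rw [Finset.sum_const, Finset.card_range, nsmul_eq_mul, ← hmh]
    ring
  rw [Metric.tendsto_atTop']
  intro ε hε
  -- Makes the oscillation error at most `ε / 2`; `t + 1` replaces `t` to allow `t = 0`.
  set δ := ε / (2 * (Real.exp t * (t + 1))) with hδ
  have hδ0 : 0 < δ := by positivity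
  have hsmall : Tendsto (fun m : ℕ => Real.exp t * (t / m * (t * K))) atTop (𝓝 0) := by
    have := ((tendsto_const_div_atTop_nhds_zero_nat t).mul_const (t * K)).const_mul (Real.exp t)
    simpa using this
  obtain ⟨N, hN⟩ := eventually_atTop.1
    ((hkey δ hδ0).and (hsmall.eventually_lt_const (half_pos hε)))
  refine ⟨N, fun m hm => ?_⟩
  obtain ⟨h1, h2⟩ := hN m hm.le
  rw [dist_comm, dist_eq_norm]
  have h3 : Real.exp t * (t * δ) ≤ ε / 2 := by
    have : Real.exp t * ((t + 1) * δ) = ε / 2 := by rw [hδ]; field_simp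
    rw [← this]
    gcongr
    linarith
  linarith

/-- The variance of `expSum b t m` for a standard real Brownian motion `b`. -/
noncomputable def expSumVar (t : ℝ) (m : ℕ) : ℝ :=
  ∑ k ∈ Finset.range m, Real.exp (k * (t / m)) ^ 2 * (t / m)

/-- A geometric sum: with `x = 2t / m` it equals `(exp (2t) - 1) / 2` times `x / (exp x - 1)`, and
the last factor tends to `1`. -/
lemma tendsto_expSumVar {t : ℝ} (ht : 0 < t) :
    Tendsto (expSumVar t) atTop (𝓝 ((Real.exp (2 * t) - 1) / 2)) := by
  have hslope : Tendsto (fun x : ℝ => (Real.exp x - 1) / x) (𝓝[≠] 0) (𝓝 1) := by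
    have h := (Real.hasDerivAt_exp 0).tendsto_slope_zero
    simp only [zero_add, Real.exp_zero, smul_eq_mul] at h
    refine h.congr fun x => by ring
  have hseq : Tendsto (fun m : ℕ => 2 * (t / m)) atTop (𝓝[≠] 0) := by
    refine tendsto_nhdsWithin_iff.2 ⟨?_, ?_⟩
    · simpa using (tendsto_const_div_atTop_nhds_zero_nat t).const_mul 2
    · filter_upwards [eventually_gt_atTop 0] with m hm
      have : (0 : ℝ) < m := by exact_mod_cast hm
      have : 0 < 2 * (t / m) := by positivity
      exact this.ne'
  have hlim := ((hslope.comp hseq).inv₀ one_ne_zero).const_mul ((Real.exp (2 * t) - 1) / 2)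
  rw [inv_one, mul_one] at hlim
  refine hlim.congr' ?_
  filter_upwards [eventually_gt_atTop 0] with m hm
  have hm' : (0 : ℝ) < m := by exact_mod_cast hm
  have hpos : 0 < 2 * (t / m) := by positivity
  have hr : Real.exp (2 * (t / m)) ≠ 1 := by
    rw [Ne, Real.exp_eq_one_iff]; exact hpos.ne'
  have hgeom : ∑ k ∈ Finset.range m, Real.exp (k * (t / m)) ^ 2 =
      (Real.exp (2 * t) - 1) / (Real.exp (2 * (t / m)) - 1) := by
    have h1 : ∀ k : ℕ, Real.exp (k * (t / m)) ^ 2 = Real.exp (2 * (t / m)) ^ k := by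
      intro k
      rw [← Real.exp_nat_mul, ← Real.exp_nat_mul]
      congr 1; push_cast; ring
    simp_rw [h1]
    rw [geom_sum_eq hr, ← Real.exp_nat_mul]
    congr 3
    field_simp
  rw [expSumVar, ← Finset.sum_mul, hgeom]
  have : Real.exp (2 * (t / m)) - 1 ≠ 0 := sub_ne_zero.2 hr
  simp only [Function.comp_apply]
  field_simp

/-! ### Gaussian law of the sums, and of the process in the limit. -/

section Brownian

variable {Ω : Type*} [MeasurableSpace Ω] {P : Measure Ω}

lemma aemeasurable_expSum {E : Type*} [NormedAddCommGroup E] [NormedSpace ℝ E]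
    [MeasurableSpace E] [BorelSpace E] [SecondCountableTopology E] {b : ℝ≥0 → Ω → E}
    (hb : ∀ t, AEMeasurable (b t) P) (t : ℝ) (m : ℕ) :
    AEMeasurable (fun ω => expSum (fun s => b s.toNNReal ω) t m) P := by
  unfold expSum
  exact Finset.aemeasurable_fun_sum _ fun k _ => by fun_prop (disch := simp [hb])

/-- The weights are deterministic and the increments independent Gaussians of variance `t / m`, so
the characteristic function factorizes. -/
lemma charFun_expSum {b : ℝ≥0 → Ω → ℝ} (hb : IsPreBrownianReal b P) {t : ℝ} (ht : 0 ≤ t) (m : ℕ)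
    (y : ℝ) :
    charFun (P.map fun ω => expSum (fun s => b s.toNNReal ω) t m) y =
      Complex.exp (-(expSumVar t m * y ^ 2 / 2 : ℝ)) := by
  have := hb.isGaussianProcess.isProbabilityMeasure
  set τ : ℕ → ℝ≥0 := fun k => (k * (t / m)).toNNReal with hτ
  have hτm : Monotone τ := fun i j hij => Real.toNNReal_mono
    (mul_le_mul_of_nonneg_right (by exact_mod_cast hij) (by positivity))
  have hinc := hb.hasIndepIncrements.nat hτm
  have hind := hinc.comp (fun (k : ℕ) (x : ℝ) => Real.exp (k * (t / m)) * x)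
    (fun k => by fun_prop)
  have hmeas : ∀ k, AEMeasurable (fun ω => b (τ (k + 1)) ω - b (τ k) ω) P := fun k =>
    (hb.aemeasurable _).sub (hb.aemeasurable _)
  have h := iIndepFun.charFun_map_fun_finsetSum_eq_prod (s := Finset.range m)
    (fun k _ => (hmeas k).const_mul (Real.exp (k * (t / m)))) (hind.restrict _)
  have e : (fun ω => expSum (fun s => b s.toNNReal ω) t m) = fun ω => ∑ k ∈ Finset.range m,
      Real.exp (k * (t / m)) * (b (τ (k + 1)) ω - b (τ k) ω) := by
    ext ω; simp [expSum, hτ]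
  rw [e, h, Finset.prod_apply]
  have hterm : ∀ k ∈ Finset.range m, charFun (P.map fun ω =>
      Real.exp (k * (t / m)) * (b (τ (k + 1)) ω - b (τ k) ω)) y =
      Complex.exp (-(Real.exp (k * (t / m)) ^ 2 * (t / m) * y ^ 2 / 2 : ℝ)) := by
    intro k _
    rw [charFun_map_mul_comp (hmeas k)]
    have hlaw := (hb.hasLaw_sub (τ (k + 1)) (τ k)).map_eq
    have hdist : ((nndist (τ (k + 1)).1 (τ k).1 : ℝ≥0) : ℝ) = t / m := by
      have h1 : ((τ (k + 1) : ℝ≥0) : ℝ) = (k + 1) * (t / m) := by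
        rw [hτ]; simp only [Nat.cast_add, Nat.cast_one]
        exact Real.coe_toNNReal _ (by positivity)
      have h2 : ((τ k : ℝ≥0) : ℝ) = k * (t / m) := Real.coe_toNNReal _ (by positivity)
      change dist ((τ (k + 1) : ℝ≥0) : ℝ) ((τ k : ℝ≥0) : ℝ) = _
      rw [h1, h2, Real.dist_eq, show ((k : ℝ) + 1) * (t / m) - k * (t / m) = t / m by ring,
        abs_of_nonneg (by positivity)]
    change charFun (P.map (b (τ (k + 1)) - b (τ k))) _ = _
    rw [hlaw, charFun_gaussianReal, hdist]
    congr 1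
    push_cast
    ring
  rw [Finset.prod_congr rfl hterm, ← Complex.exp_sum, expSumVar, ← Complex.ofReal_neg]
  congr 1
  push_cast
  rw [Finset.sum_neg_distrib, Finset.sum_mul, Finset.sum_div]

lemma expSum_apply (b : ℝ → EuclideanSpace ℝ (Fin n)) (t : ℝ) (m : ℕ) (i : Fin n) :
    expSum b t m i = expSum (fun s => b s i) t m := by
  simp [expSum]

lemma IsStandardBrownian.charFun_expSum {B : ℝ≥0 → Ω → EuclideanSpace ℝ (Fin n)}
    (hB : IsStandardBrownian B P) [IsProbabilityMeasure P] {t : ℝ} (ht : 0 ≤ t) (m : ℕ)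
    (u : EuclideanSpace ℝ (Fin n)) :
    ∫ ω, Complex.exp (⟪expSum (fun s => B s.toNNReal ω) t m, u⟫ * Complex.I) ∂P =
      Complex.exp (-(expSumVar t m * ‖u‖ ^ 2 / 2 : ℝ)) := by
  have hmeas : ∀ i : Fin n, AEMeasurable
      (fun ω => expSum (fun s => B s.toNNReal ω i) t m) P := fun i =>
    aemeasurable_expSum (b := fun t ω => B t ω i) (fun t => (hB.coord i).aemeasurable t) t m
  have hind : iIndepFun (fun (i : Fin n) ω => expSum (fun s => B s.toNNReal ω i) t m) P := by
    refine hB.indep.comp (fun _ p => expSum (fun s => p s.toNNReal) t m) fun i => ?_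
    unfold expSum
    fun_prop
  have h := hind.integral_fun_prod_comp hmeas
    (f := fun (i : Fin n) (x : ℝ) => Complex.exp (x * u i * Complex.I))
    (fun i => Measurable.aestronglyMeasurable (by fun_prop))
  have e : ∀ ω, Complex.exp (⟪expSum (fun s => B s.toNNReal ω) t m, u⟫ * Complex.I) =
      ∏ i, Complex.exp ((expSum (fun s => B s.toNNReal ω i) t m : ℝ) * u i * Complex.I) := by
    intro ω
    rw [← Complex.exp_sum, ← Finset.sum_mul, PiLp.inner_apply]
    simp only [expSum_apply]
    congr 2
    push_cast
    refine Finset.sum_congr rfl fun i _ => ?_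
    simp [mul_comm]
  simp_rw [e]
  rw [h]
  have hterm : ∀ i : Fin n,
      ∫ ω, Complex.exp ((expSum (fun s => B s.toNNReal ω i) t m : ℝ) * u i * Complex.I) ∂P =
      Complex.exp (-(expSumVar t m * u i ^ 2 / 2 : ℝ)) := by
    intro i
    rw [← OUCutoff.charFun_expSum (hB.coord i).toIsPreBrownianReal ht m (u i), charFun_apply_real,
      integral_map (hmeas i) (Measurable.aestronglyMeasurable (by fun_prop))]
    simp only [mul_comm]
  simp_rw [hterm]
  rw [← Complex.exp_sum]
  congr 1
  rw [EuclideanSpace.real_norm_sq_eq]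
  push_cast
  rw [Finset.sum_neg_distrib, Finset.mul_sum, Finset.sum_div]

/-- `Z_t` is the almost sure limit of the Gaussian variables `X m`; their characteristic functions
converge by dominated convergence, the integrands having modulus `1`. -/
theorem IsOrnsteinUhlenbeck.map_eq {z : EuclideanSpace ℝ (Fin n)}
    {Z : ℝ≥0 → Ω → EuclideanSpace ℝ (Fin n)} [IsProbabilityMeasure P]
    (hZ : IsOrnsteinUhlenbeck z Z P) {t : ℝ} (ht : 0 < t) :
    P.map (Z t.toNNReal) = isoGaussian (Real.exp (-t) • z) ((1 - Real.exp (-2 * t)) / n) := by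
  obtain ⟨B, hB, hsde⟩ := hZ.sde
  have hvar : 0 ≤ (1 - Real.exp (-2 * t)) / n := by
    have : Real.exp (-2 * t) ≤ 1 := Real.exp_le_one_iff.2 (by linarith)
    exact div_nonneg (by linarith) (by positivity)
  have := Measure.isProbabilityMeasure_map (hZ.aemeasurable t.toNNReal)
  set σ := √(2 / (n : ℝ)) with hσ
  have hB0 : ∀ᵐ ω ∂P, B 0 ω = 0 := by
    have : ∀ᵐ ω ∂P, ∀ i, B 0 ω i = 0 := ae_all_iff.2 fun i => (hB.coord i).eval_zero_ae_eq_zero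
    filter_upwards [this] with ω hω
    ext i
    simpa using hω i
  set X : ℕ → Ω → EuclideanSpace ℝ (Fin n) := fun m ω =>
    Real.exp (-t) • (z + σ • expSum (fun s => B s.toNNReal ω) t m) with hX
  have hlim : ∀ᵐ ω ∂P, Tendsto (fun m => X m ω) atTop (𝓝 (Z t.toNNReal ω)) := by
    filter_upwards [hZ.continuous_paths, hsde, hB0] with ω hc hs h0
    have hf : Continuous fun s : ℝ => Z s.toNNReal ω := hc.comp continuous_real_toNNReal
    -- The initial condition comes from the integral equation at time `0`, where `B` vanishes almost
    -- surely.
    have hZ0 : Z 0 ω = z := by rw [hs 0, h0]; simp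
    have h1 := tendsto_expSum (f := fun s : ℝ => Z s.toNNReal ω) (b := fun s => B s.toNNReal ω)
      (z := z) (σ := σ) hf ht.le fun s hs0 => by
        have := hs s.toNNReal
        rw [Real.coe_toNNReal s hs0] at this
        exact this
    have h2 := (h1.const_add z).const_smul (Real.exp (-t))
    simp only [Real.toNNReal_zero, hZ0, add_sub_cancel, smul_smul, ← Real.exp_add, neg_add_cancel,
      Real.exp_zero, one_smul] at h2
    exact h2
  have hBmeas : ∀ s, AEMeasurable (B s) P := fun s => by
    have h := aemeasurable_pi_lambda (fun ω i => B s ω i) fun i => (hB.coord i).aemeasurable s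
    exact (MeasurableEquiv.toLp 2 (Fin n → ℝ)).measurable.comp_aemeasurable h
  have hXmeas : ∀ m, AEMeasurable (X m) P := fun m => by
    have := aemeasurable_expSum hBmeas t m
    fun_prop
  apply Measure.ext_of_charFun
  ext u
  rw [charFun_isoGaussian hvar, charFun_apply, integral_map (hZ.aemeasurable _)
    (Measurable.aestronglyMeasurable (by fun_prop))]
  have hconv : Tendsto (fun m => ∫ ω, Complex.exp (⟪X m ω, u⟫ * Complex.I) ∂P) atTop
      (𝓝 (∫ ω, Complex.exp (⟪Z t.toNNReal ω, u⟫ * Complex.I) ∂P)) := by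
    refine tendsto_integral_of_dominated_convergence (fun _ => 1) (fun m => ?_)
      (integrable_const _) (fun m => ae_of_all _ fun ω => ?_) ?_
    · exact (Measurable.comp_aemeasurable (g := fun x : EuclideanSpace ℝ (Fin n) =>
        Complex.exp (⟪x, u⟫ * Complex.I)) (by fun_prop) (hXmeas m)).aestronglyMeasurable
    · rw [Complex.norm_exp_ofReal_mul_I]
    · filter_upwards [hlim] with ω hω
      have hcont : Continuous fun x : EuclideanSpace ℝ (Fin n) =>
        Complex.exp (⟪x, u⟫ * Complex.I) := by fun_prop
      exact (hcont.tendsto _).comp hω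
  refine tendsto_nhds_unique hconv ?_
  have hval : ∀ m, ∫ ω, Complex.exp (⟪X m ω, u⟫ * Complex.I) ∂P =
      Complex.exp (⟪u, Real.exp (-t) • z⟫ * Complex.I -
        (Real.exp (-t) ^ 2 * (2 / n) * expSumVar t m * ‖u‖ ^ 2 : ℝ) / 2) := by
    intro m
    have h := hB.charFun_expSum ht.le m ((Real.exp (-t) * σ) • u)
    have e : ∀ ω, Complex.exp (⟪X m ω, u⟫ * Complex.I) =
        Complex.exp (⟪u, Real.exp (-t) • z⟫ * Complex.I) * Complex.exp
          (⟪expSum (fun s => B s.toNNReal ω) t m, (Real.exp (-t) * σ) • u⟫ * Complex.I) := by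
      intro ω
      rw [← Complex.exp_add, ← add_mul, ← Complex.ofReal_add, real_inner_comm]
      congr 3
      simp only [hX, inner_smul_right, inner_add_right, smul_add, real_inner_comm]
      ring
    simp_rw [e]
    rw [integral_const_mul, h, ← Complex.exp_add, norm_smul, mul_pow, Real.norm_eq_abs, sq_abs,
      mul_pow, hσ, Real.sq_sqrt (by positivity)]
    congr 1
    push_cast
    ring
  simp_rw [hval]
  have hv := (((tendsto_expSumVar ht).const_mul (Real.exp (-t) ^ 2 * (2 / n))).mul_const (‖u‖ ^ 2))
  have hlimval : Real.exp (-t) ^ 2 * (2 / n) * ((Real.exp (2 * t) - 1) / 2) * ‖u‖ ^ 2 =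
      (1 - Real.exp (-2 * t)) / n * ‖u‖ ^ 2 := by
    have e1 : Real.exp (-t) ^ 2 = Real.exp (-2 * t) := by
      rw [← Real.exp_nat_mul]; congr 1; push_cast; ring
    have e2 : Real.exp (-2 * t) * Real.exp (2 * t) = 1 := by
      rw [← Real.exp_add]; simp
    rw [e1]
    linear_combination (‖u‖ ^ 2 / n) * e2
  rw [hlimval] at hv
  have hcont : Continuous fun x : ℝ =>
      Complex.exp (⟪u, Real.exp (-t) • z⟫ * Complex.I - (x : ℂ) / 2) := by fun_prop
  exact (hcont.tendsto _).comp hv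

end Brownian

end

section

variable {n : ℕ}

/-! ### Weak gradients and Fisher information -/

/-- The fundamental lemma of the calculus of variations. It reduces the infimum defining `fisher` to
a single value. -/
lemma IsWeakGradient.ae_eq {h h' : EuclideanSpace ℝ (Fin n) → ℝ}
    {g g' : EuclideanSpace ℝ (Fin n) → EuclideanSpace ℝ (Fin n)} (hg : IsWeakGradient h g)
    (hg' : IsWeakGradient h' g') (hh : h =ᵐ[volume] h') : g =ᵐ[volume] g' := by
  refine ae_eq_of_integral_contDiff_smul_eq hg.locallyIntegrable_grad hg'.locallyIntegrable_grad
    fun φ hφ hφc => ?_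
  have hint : ∀ G : EuclideanSpace ℝ (Fin n) → EuclideanSpace ℝ (Fin n),
      LocallyIntegrable G volume → Integrable (fun x => φ x • G x) := fun G hG =>
    hG.integrable_smul_left_of_hasCompactSupport hφ.continuous hφc
  refine ext_inner_left ℝ fun v => ?_
  rw [← integral_inner (hint g hg.locallyIntegrable_grad),
    ← integral_inner (hint g' hg'.locallyIntegrable_grad)]
  have h1 := hg.integral_by_parts φ hφ hφc v
  have h2 := hg'.integral_by_parts φ hφ hφc v
  have h3 : ∫ x, h x * fderiv ℝ φ x v = ∫ x, h' x * fderiv ℝ φ x v :=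
    integral_congr_ae (by filter_upwards [hh] with x hx; rw [hx])
  rw [h1, h2, neg_inj] at h3
  simpa only [inner_smul_right, real_inner_comm v, mul_comm] using h3

lemma IsWeakGradient.congr {h h' : EuclideanSpace ℝ (Fin n) → ℝ}
    {g : EuclideanSpace ℝ (Fin n) → EuclideanSpace ℝ (Fin n)} (hg : IsWeakGradient h g)
    (hh : h =ᵐ[volume] h') : IsWeakGradient h' g where
  locallyIntegrable := hg.locallyIntegrable.congr hh
  locallyIntegrable_grad := hg.locallyIntegrable_grad
  integral_by_parts φ hφ hφc v := by
    rw [← hg.integral_by_parts φ hφ hφc v]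
    exact integral_congr_ae (by filter_upwards [hh] with x hx; rw [hx])

lemma isWeakGradient_of_hasGradientAt {h : EuclideanSpace ℝ (Fin n) → ℝ}
    {g : EuclideanSpace ℝ (Fin n) → EuclideanSpace ℝ (Fin n)} (hg : Continuous g)
    (hd : ∀ x, HasGradientAt h (g x) x) : IsWeakGradient h g := by
  have hdiff : Differentiable ℝ h := fun x => (hd x).differentiableAt
  have hcont : Continuous h := hdiff.continuous
  refine ⟨hcont.locallyIntegrable, hg.locallyIntegrable, fun φ hφ hφc v => ?_⟩
  have hfd : ∀ x, fderiv ℝ h x v = ⟪g x, v⟫ := fun x => by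
    rw [(hd x).hasFDerivAt.fderiv]
    rfl
  have hφ' : Continuous fun x => fderiv ℝ φ x v :=
    (hφ.continuous_fderiv (by simp)).clm_apply continuous_const
  have hφ'c : HasCompactSupport fun x => fderiv ℝ φ x v :=
    hφc.fderiv_apply (𝕜 := ℝ) v
  rw [integral_mul_fderiv_eq_neg_fderiv_mul_of_integrable (f := h) (g := φ)]
  · simp_rw [hfd]
  · simp_rw [hfd]
    exact Continuous.integrable_of_hasCompactSupport (by fun_prop (disch := exact hφ.continuous))
      hφc.mul_left
  · exact Continuous.integrable_of_hasCompactSupport (hcont.mul hφ') hφ'c.mul_left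
  · exact Continuous.integrable_of_hasCompactSupport (hcont.mul hφ.continuous) hφc.mul_left
  · exact fun x _ => hdiff x
  · exact fun x _ => hφ.differentiable (by simp) x

/-- `∇√f = (√f / 2) ∇ log f`, and the score `x / τ - (x - m) / s` is written around `m`, the centre
of the law under which it will be integrated. -/
lemma hasGradientAt_sqrt_gaussRatio {s τ : ℝ} (hs : 0 < s) (hτ : 0 < τ)
    (m x : EuclideanSpace ℝ (Fin n)) :
    HasGradientAt (fun x => √(gaussRatio m s τ x))
      ((√(gaussRatio m s τ x) / 2) • (τ⁻¹ • m + (τ⁻¹ - s⁻¹) • (x - m))) x := by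
  rw [hasGradientAt_iff_hasFDerivAt]
  have h1 : HasFDerivAt (fun x : EuclideanSpace ℝ (Fin n) => ‖x‖ ^ 2 / (2 * τ)) _ x :=
    ((hasFDerivAt_id x).norm_sq).mul_const (2 * τ)⁻¹
  have h2 : HasFDerivAt (fun x : EuclideanSpace ℝ (Fin n) => ‖x - m‖ ^ 2 / (2 * s)) _ x :=
    (((hasFDerivAt_id x).sub_const m).norm_sq).mul_const (2 * s)⁻¹
  have h3 : HasFDerivAt (gaussRatio m s τ) _ x :=
    ((h1.sub h2).exp).const_mul ((τ / s) ^ (n / 2 : ℝ))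
  refine (h3.sqrt (gaussRatio_pos hs hτ m x).ne').congr_fderiv ?_
  ext v
  have hf := gaussRatio_pos hs hτ m x
  have hsq := Real.sq_sqrt hf.le
  have hsp := Real.sqrt_pos.2 hf
  simp only [smul_apply, sub_apply, smul_eq_mul,
    InnerProductSpace.toDual_apply_apply, inner_smul_left, inner_add_left, inner_sub_left,
    conj_trivial]
  simp
  have hval : (τ / s) ^ (n / 2 : ℝ) * Real.exp (‖x‖ ^ 2 / (2 * τ) - ‖x - m‖ ^ 2 / (2 * s)) =
    √(gaussRatio m s τ x) ^ 2 := hsq.symm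
  rw [← mul_assoc ((τ / s) ^ (n / 2 : ℝ)), hval]
  field_simp
  ring

/-- `4 |∇√f|² = f |∇ log f|²`, so the value is the second moment of the affine score under `𝒩(m, s
Iₙ)`. -/
theorem fisher_isoGaussian {s τ : ℝ} (hs : 0 < s) (hτ : 0 < τ)
    (m : EuclideanSpace ℝ (Fin n)) :
    fisher (isoGaussian m s) (isoGaussian 0 τ) =
      ENNReal.ofReal (‖τ⁻¹ • m‖ ^ 2 + (τ⁻¹ - s⁻¹) ^ 2 * (s * n)) := by
  set L : EuclideanSpace ℝ (Fin n) → EuclideanSpace ℝ (Fin n) :=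
    fun x => τ⁻¹ • m + (τ⁻¹ - s⁻¹) • (x - m) with hL
  set G : EuclideanSpace ℝ (Fin n) → EuclideanSpace ℝ (Fin n) :=
    fun x => (√(gaussRatio m s τ x) / 2) • L x with hG
  have hLc : Continuous L := by fun_prop
  have hGc : Continuous G :=
    ((continuous_gaussRatio m s τ).sqrt.div_const 2).smul hLc
  have hGw : IsWeakGradient (fun x => √(gaussRatio m s τ x)) G :=
    isWeakGradient_of_hasGradientAt hGc (hasGradientAt_sqrt_gaussRatio hs hτ m)
  have hae : (fun x => √(gaussRatio m s τ x)) =ᵐ[volume]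
      fun x => √((isoGaussian m s).rnDeriv (isoGaussian 0 τ) x).toReal := by
    filter_upwards [volume_absolutelyContinuous_isoGaussian hτ 0
      (toReal_rnDeriv_isoGaussian hs hτ m)]
      with x hx
    exact congrArg Real.sqrt hx.symm
  have hval : 4 * ∫⁻ x, ‖G x‖ₑ ^ 2 ∂(isoGaussian 0 τ) =
      ENNReal.ofReal (‖τ⁻¹ • m‖ ^ 2 + (τ⁻¹ - s⁻¹) ^ 2 * (s * n)) := by
    rw [← lintegral_enorm_sq_affine_isoGaussian hs.le,
      isoGaussian_eq_withDensity_isoGaussian hs hτ, lintegral_withDensity_eq_lintegral_mul _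
        (continuous_gaussRatio m s τ).measurable.ennreal_ofReal (by fun_prop),
      ← lintegral_const_mul _ (by fun_prop)]
    refine lintegral_congr fun x => ?_
    rw [Pi.mul_apply, hG, enorm_smul, mul_pow, ← mul_assoc]
    congr 1
    rw [Real.enorm_of_nonneg (by positivity), ← ENNReal.ofReal_pow (by positivity), div_pow,
      Real.sq_sqrt (gaussRatio_pos hs hτ m x).le,
      show (4 : ℝ≥0∞) = ENNReal.ofReal 4 by simp, ← ENNReal.ofReal_mul (by norm_num)]
    congr 1
    ring
  rw [fisher, if_pos (isoGaussian_absolutelyContinuous hs hτ m)]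
  refine le_antisymm (iInf₂_le_of_le G (hGw.congr hae) hval.le) (le_iInf₂ fun g hg => ?_)
  have hgG : g =ᵐ[isoGaussian 0 τ] G :=
    (isoGaussian_absolutelyContinuous_volume hτ 0).ae_eq (hg.ae_eq hGw hae.symm)
  rw [← hval]
  refine le_of_eq (congrArg (4 * ·) (lintegral_congr_ae ?_))
  filter_upwards [hgG] with x hx
  rw [hx]

end

/-! ### Divergences along sequences -/

lemma chiSquare_isoGaussian {n : ℕ} {s τ : ℝ} (hs : 0 < s) (hτ : 0 < τ) (hsτ : s < 2 * τ)
    (m : EuclideanSpace ℝ (Fin n)) :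
    chiSquare (isoGaussian m s) (isoGaussian 0 τ) =
      ENNReal.ofReal ((τ ^ 2 / (s * (2 * τ - s))) ^ (n / 2 : ℝ) *
        Real.exp (‖m‖ ^ 2 / (2 * τ - s)) - 1) := by
  have hf := continuous_gaussRatio m s τ
  have h2τ : 0 < 2 * τ - s := by linarith
  have hmass : ∫⁻ x, ENNReal.ofReal (gaussRatio m s τ x) ∂(isoGaussian 0 τ) = 1 := by
    rw [← setLIntegral_univ, ← withDensity_apply _ MeasurableSet.univ,
      ← isoGaussian_eq_withDensity_isoGaussian hs hτ, measure_univ]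
  -- `(f - 1)² + 2f = f² + 1`, arranged so that no subtraction occurs in `ℝ≥0∞`.
  have hadd : ∫⁻ x, ENNReal.ofReal ((gaussRatio m s τ x - 1) ^ 2) ∂(isoGaussian 0 τ) +
        ENNReal.ofReal 2 =
      ∫⁻ x, ENNReal.ofReal (gaussRatio m s τ x ^ 2) ∂(isoGaussian 0 τ) + 1 := by
    have e1 : ENNReal.ofReal 2 =
        ∫⁻ x, ENNReal.ofReal 2 * ENNReal.ofReal (gaussRatio m s τ x) ∂(isoGaussian 0 τ) := by
      rw [lintegral_const_mul _ (by fun_prop), hmass, mul_one]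
    have e2 : (1 : ℝ≥0∞) = ∫⁻ _, 1 ∂(isoGaussian (n := n) 0 τ) := by simp
    conv_lhs => rw [e1]
    conv_rhs => rw [e2]
    rw [← lintegral_add_left (by fun_prop), ← lintegral_add_left (by fun_prop)]
    refine lintegral_congr fun x => ?_
    have hp := gaussRatio_pos hs hτ m x
    rw [← ENNReal.ofReal_one, ← ENNReal.ofReal_mul (by norm_num),
      ← ENNReal.ofReal_add (by positivity) (by positivity),
      ← ENNReal.ofReal_add (by positivity) (by positivity)]
    congr 1
    ring
  have hchi : chiSquare (isoGaussian m s) (isoGaussian 0 τ) =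
      ∫⁻ x, ENNReal.ofReal ((gaussRatio m s τ x - 1) ^ 2) ∂(isoGaussian 0 τ) := by
    rw [chiSquare, if_pos (isoGaussian_absolutelyContinuous hs hτ m)]
    refine lintegral_congr_ae ?_
    filter_upwards [toReal_rnDeriv_isoGaussian hs hτ m] with x hx
    rw [hx]
  rw [hchi, ENNReal.eq_sub_of_add_eq (by simp) hadd, lintegral_sq_gaussRatio hs hτ hsτ,
    ← ENNReal.ofReal_one, ← ENNReal.ofReal_add (by positivity) (by norm_num),
    ← ENNReal.ofReal_sub _ (by norm_num)]
  congr 1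
  ring

section Sequences

variable {ν μ : ∀ n : ℕ, Measure (EuclideanSpace ℝ (Fin n))} [∀ n, IsProbabilityMeasure (ν n)]
  [∀ n, IsProbabilityMeasure (μ n)]

lemma tendsto_rpow_half_zero {α : Type*} {l : Filter α} {u : α → ℝ≥0∞}
    (hu : Tendsto u l (𝓝 0)) : Tendsto (fun x => u x ^ (1 / 2 : ℝ)) l (𝓝 0) := by
  have h := (ENNReal.continuous_rpow_const (y := 1 / 2)).tendsto 0 |>.comp hu
  rwa [ENNReal.zero_rpow_of_pos (by norm_num)] at h

lemma tendsto_totalVariation_zero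
    (h : Tendsto (fun n => chiSquare (ν n) (μ n)) atTop (𝓝 0)) :
    Tendsto (fun n => totalVariation (ν n) (μ n)) atTop (𝓝 0) :=
  tendsto_of_tendsto_of_tendsto_of_le_of_le tendsto_const_nhds (tendsto_rpow_half_zero h)
    (fun _ => zero_le) fun n => totalVariation_le_sqrt_chiSquare (ν n) (μ n)

lemma tendsto_hellinger_zero
    (h : Tendsto (fun n => chiSquare (ν n) (μ n)) atTop (𝓝 0)) :
    Tendsto (fun n => hellinger (ν n) (μ n)) atTop (𝓝 0) :=
  tendsto_of_tendsto_of_tendsto_of_le_of_le tendsto_const_nhds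
    (tendsto_rpow_half_zero (tendsto_totalVariation_zero h))
    (fun _ => zero_le) fun n => hellinger_le_sqrt_totalVariation (ν n) (μ n)

lemma tendsto_klDiv_zero
    (h : Tendsto (fun n => chiSquare (ν n) (μ n)) atTop (𝓝 0)) :
    Tendsto (fun n => InformationTheory.klDiv (ν n) (μ n)) atTop (𝓝 0) :=
  tendsto_of_tendsto_of_tendsto_of_le_of_le tendsto_const_nhds h
    (fun _ => zero_le) fun n => klDiv_le_chiSquare (ν n) (μ n)

variable {A : ∀ n : ℕ, Set (EuclideanSpace ℝ (Fin n))}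

lemma tendsto_totalVariation_one (hA : ∀ n, MeasurableSet (A n))
    (hν : Tendsto (fun n => (ν n).real (A n)ᶜ) atTop (𝓝 0))
    (hμ : Tendsto (fun n => (μ n).real (A n)) atTop (𝓝 0)) :
    Tendsto (fun n => totalVariation (ν n) (μ n)) atTop (𝓝 1) := by
  have h : Tendsto (fun n => ENNReal.ofReal (1 - (ν n).real (A n)ᶜ - (μ n).real (A n))) atTop
      (𝓝 1) := by
    have := ENNReal.tendsto_ofReal ((tendsto_const_nhds (x := (1 : ℝ))).sub hν |>.sub hμ)
    simpa using this
  exact tendsto_of_tendsto_of_tendsto_of_le_of_le h tendsto_const_nhds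
    (fun n => one_sub_le_totalVariation (ν n) (μ n) (hA n))
    fun n => totalVariation_le_one (ν n) (μ n)

lemma tendsto_hellinger_one (hA : ∀ n, MeasurableSet (A n))
    (hν : Tendsto (fun n => (ν n).real (A n)ᶜ) atTop (𝓝 0))
    (hμ : Tendsto (fun n => (μ n).real (A n)) atTop (𝓝 0)) :
    Tendsto (fun n => hellinger (ν n) (μ n)) atTop (𝓝 1) := by
  refine tendsto_order.2 ⟨fun c hc => ?_, fun c hc =>
    Eventually.of_forall fun n => (hellinger_le_one (ν n) (μ n)).trans_lt hc⟩
  have hcont : Tendsto (fun κ : ℝ => ENNReal.ofReal (1 - κ) ^ (1 / 2 : ℝ)) (𝓝[>] 0) (𝓝 1) := by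
    have h1 : Continuous fun κ : ℝ => ENNReal.ofReal (1 - κ) ^ (1 / 2 : ℝ) :=
      ENNReal.continuous_rpow_const.comp (ENNReal.continuous_ofReal.comp (by fun_prop))
    have h2 := (h1.tendsto 0).mono_left (nhdsWithin_le_nhds (s := Set.Ioi 0))
    simpa using h2
  -- `κ` is fixed before `n` goes to infinity, so that the error divided by `2κ` still vanishes.
  obtain ⟨κ, hκ1, hκ0⟩ := ((hcont.eventually (lt_mem_nhds hc)).and self_mem_nhdsWithin).exists
  have hκ0 : 0 < κ := hκ0
  have hlim : Tendsto (fun n => ENNReal.ofReal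
      (1 - κ - ((μ n).real (A n) + (ν n).real (A n)ᶜ) / (2 * κ)) ^ (1 / 2 : ℝ)) atTop
      (𝓝 (ENNReal.ofReal (1 - κ) ^ (1 / 2 : ℝ))) := by
    have h1 := ((hμ.add hν).div_const (2 * κ)).const_sub (1 - κ)
    simp only [add_zero, zero_div, sub_zero] at h1
    exact (ENNReal.continuous_rpow_const.tendsto _).comp (ENNReal.tendsto_ofReal h1)
  filter_upwards [hlim.eventually (lt_mem_nhds hκ1)] with n hn
  exact hn.trans_le (one_sub_le_hellinger (ν n) (μ n) (hA n) hκ0)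

lemma tendsto_klDiv_top (hA : ∀ n, MeasurableSet (A n))
    (hν : Tendsto (fun n => (ν n).real (A n)ᶜ) atTop (𝓝 0))
    (hμ : Tendsto (fun n => (μ n).real (A n)) atTop (𝓝 0)) :
    Tendsto (fun n => InformationTheory.klDiv (ν n) (μ n)) atTop (𝓝 ∞) := by
  refine ENNReal.tendsto_nhds_top fun N => ?_
  -- Once `ν A ≥ 1/2`, `h ν A ≥ N + 2`, which exceeds the sum of `N` and the remainder `(exp h - 1)
  -- μ A ≤ 1`.
  set h : ℝ := 2 * (N + 2) with hh
  have h0 : 0 ≤ h := by positivity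
  have hexp : 0 ≤ Real.exp h - 1 := by have := Real.add_one_le_exp h; linarith
  have hsmall := hμ.const_mul (Real.exp h - 1)
  rw [mul_zero] at hsmall
  filter_upwards [hν.eventually_le_const (by norm_num : (0 : ℝ) < 1 / 2),
    hsmall.eventually_le_const one_pos] with n hn1 hn2
  have hkey := ofReal_mul_le_klDiv_add (ν n) (μ n) (A n) h0
  by_contra! hle
  have hνA : 1 / 2 ≤ (ν n).real (A n) := by
    have := probReal_compl_eq_one_sub (μ := ν n) (hA n)
    linarith
  rw [← ofReal_measureReal (μ := ν n), ← ofReal_measureReal (μ := μ n), ← ENNReal.ofReal_mul h0,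
    ← ENNReal.ofReal_mul hexp] at hkey
  have h1 : ENNReal.ofReal (h * (ν n).real (A n)) ≤ ENNReal.ofReal (N + 1) := by
    rw [ENNReal.ofReal_add (by positivity) (by norm_num)]
    refine hkey.trans (add_le_add (hle.trans (by simp)) (ENNReal.ofReal_le_ofReal hn2))
  rw [ENNReal.ofReal_le_ofReal_iff (by positivity)] at h1
  nlinarith

lemma tendsto_chiSquare_top (hA : ∀ n, MeasurableSet (A n))
    (hν : Tendsto (fun n => (ν n).real (A n)ᶜ) atTop (𝓝 0))
    (hμ : Tendsto (fun n => (μ n).real (A n)) atTop (𝓝 0)) :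
    Tendsto (fun n => chiSquare (ν n) (μ n)) atTop (𝓝 ∞) :=
  tendsto_nhds_top_mono (tendsto_klDiv_top hA hν hμ)
    (Eventually.of_forall fun n => klDiv_le_chiSquare (ν n) (μ n))

end Sequences

instance (n : ℕ) : IsProbabilityMeasure (equilibrium n) :=
  inferInstanceAs (IsProbabilityMeasure (multivariateGaussian _ _))

/-! ### Isotropic Gaussian laws of variance close to the equilibrium -/

section Asymptotics

lemma tendsto_natCast_rpow_zero {p : ℝ} (hp : p < 0) :
    Tendsto (fun n : ℕ => (n : ℝ) ^ p) atTop (𝓝 0) := by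
  have h := (tendsto_rpow_neg_atTop (neg_pos.2 hp)).comp (tendsto_natCast_atTop_atTop (R := ℝ))
  rw [neg_neg] at h
  exact h

lemma tendsto_natCast_rpow_atTop {p : ℝ} (hp : 0 < p) :
    Tendsto (fun n : ℕ => (n : ℝ) ^ p) atTop atTop :=
  (tendsto_rpow_atTop hp).comp tendsto_natCast_atTop_atTop

/-- The time `θ log n` of the Ornstein-Uhlenbeck process, started from a point whose squared norm is
of order `n`, in terms of `q = exp (-2 θ log n)`. -/
structure IsOUScaling (θ a b : ℝ) (m : ∀ n : ℕ, EuclideanSpace ℝ (Fin n)) : Prop where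
  theta_pos : 0 < θ
  pos : 0 < a
  lower : ∀ᶠ n : ℕ in atTop, a * (n : ℝ) ^ (1 - 2 * θ) ≤ ‖m n‖ ^ 2
  upper : ∀ᶠ n : ℕ in atTop, ‖m n‖ ^ 2 ≤ b * (n : ℝ) ^ (1 - 2 * θ)

/-- The law `𝒩(m, (1 - q) Iₙ / n)` with `q = n ^ (-2θ)`. -/
noncomputable abbrev ouLaw (θ : ℝ) (m : ∀ n : ℕ, EuclideanSpace ℝ (Fin n)) (n : ℕ) :
    Measure (EuclideanSpace ℝ (Fin n)) :=
  isoGaussian (m n) ((1 - (n : ℝ) ^ (-2 * θ)) / n)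

variable {θ a b : ℝ} {m : ∀ n : ℕ, EuclideanSpace ℝ (Fin n)}

lemma natCast_mul_rpow {n : ℕ} (hn : 0 < n) (p : ℝ) :
    (n : ℝ) * (n : ℝ) ^ p = (n : ℝ) ^ (1 + p) := by
  rw [Real.rpow_add (by exact_mod_cast hn), Real.rpow_one]

namespace IsOUScaling

variable (h : IsOUScaling θ a b m)
include h

lemma tendsto_q : Tendsto (fun n : ℕ => (n : ℝ) ^ (-2 * θ)) atTop (𝓝 0) :=
  tendsto_natCast_rpow_zero (by linarith [h.theta_pos])

lemma tendsto_wasserstein_top (hθ : θ < 1 / 2) :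
    Tendsto (fun n => wasserstein (ouLaw θ m n) (equilibrium n)) atTop (𝓝 ∞) := by
  have h1 : Tendsto (fun n : ℕ => ENNReal.ofReal (a * (n : ℝ) ^ (1 - 2 * θ)) ^ (1 / 2 : ℝ)) atTop
      (𝓝 ∞) := by
    have h2 := ENNReal.tendsto_ofReal_atTop.comp
      ((tendsto_natCast_rpow_atTop (by linarith : 0 < 1 - 2 * θ)).const_mul_atTop h.pos)
    have h3 := (ENNReal.continuous_rpow_const (y := 1 / 2)).tendsto ∞ |>.comp h2
    rwa [ENNReal.top_rpow_of_pos (by norm_num)] at h3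
  refine tendsto_nhds_top_mono h1 ?_
  filter_upwards [h.lower] with n hn
  have h4 := enorm_mean_le_wasserstein (ν := ouLaw θ m n) (μ := equilibrium n)
    (by exact IsGaussian.integrable_id)
    (by unfold equilibrium; exact IsGaussian.integrable_id)
  rw [equilibrium, integral_id_multivariateGaussian, integral_id_multivariateGaussian,
    sub_zero] at h4
  refine le_trans ?_ h4
  refine (ENNReal.rpow_le_rpow (ENNReal.ofReal_le_ofReal hn) (by norm_num)).trans (le_of_eq ?_)
  rw [ENNReal.ofReal_pow (norm_nonneg _), ofReal_norm, ← ENNReal.rpow_natCast, ← ENNReal.rpow_mul]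
  norm_num

lemma tendsto_wasserstein_zero (hθ : 1 / 2 < θ) :
    Tendsto (fun n => wasserstein (ouLaw θ m n) (equilibrium n)) atTop (𝓝 0) := by
  have h1 : Tendsto (fun n : ℕ => ENNReal.ofReal (b * (n : ℝ) ^ (1 - 2 * θ) +
      (√(1 - (n : ℝ) ^ (-2 * θ)) - 1) ^ 2) ^ (1 / 2 : ℝ)) atTop (𝓝 0) := by
    refine tendsto_rpow_half_zero ?_
    rw [← ENNReal.ofReal_zero]
    refine ENNReal.tendsto_ofReal ?_
    have e1 := (tendsto_natCast_rpow_zero (by linarith : 1 - 2 * θ < 0)).const_mul b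
    have e2 := (((h.tendsto_q.const_sub 1).sqrt).sub_const 1).pow 2
    simpa using e1.add e2
  refine tendsto_of_tendsto_of_tendsto_of_le_of_le' tendsto_const_nhds h1
    (Eventually.of_forall fun _ => zero_le) ?_
  filter_upwards [h.upper, h.tendsto_q.eventually_le_const one_pos, eventually_gt_atTop 0]
    with n hn hq hn0
  have hn0' : (0 : ℝ) < n := by exact_mod_cast hn0
  have h2 := wasserstein_affine_le (τ := 1 / (n : ℝ)) (by positivity) (m n)
    √(1 - (n : ℝ) ^ (-2 * θ))
  rw [Real.sq_sqrt (by linarith), mul_one_div] at h2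
  refine h2.trans (ENNReal.rpow_le_rpow (ENNReal.ofReal_le_ofReal ?_) (by norm_num))
  rw [one_div_mul_cancel hn0'.ne', mul_one]
  linarith

/-- Both Chebyshev bounds are at most `4 / (n ‖m‖²)`, hence of order `n ^ (2θ - 2)`. -/
lemma separated (hθ : θ < 1) :
    Tendsto (fun n => (ouLaw θ m n).real {x | ‖m n‖ ^ 2 / 2 ≤ ⟪m n, x⟫}ᶜ) atTop (𝓝 0) ∧
    Tendsto (fun n => (equilibrium n).real {x | ‖m n‖ ^ 2 / 2 ≤ ⟪m n, x⟫}) atTop (𝓝 0) := by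
  have hδ : Tendsto (fun n : ℕ => 4 / a * (n : ℝ) ^ (2 * θ - 2)) atTop (𝓝 0) := by
    simpa using (tendsto_natCast_rpow_zero (by linarith : 2 * θ - 2 < 0)).const_mul (4 / a)
  have hbound : ∀ᶠ n : ℕ in atTop, m n ≠ 0 ∧ 0 ≤ (1 - (n : ℝ) ^ (-2 * θ)) / n ∧
      4 * ((1 - (n : ℝ) ^ (-2 * θ)) / n) / ‖m n‖ ^ 2 ≤ 4 / a * (n : ℝ) ^ (2 * θ - 2) ∧
      4 * (1 / (n : ℝ)) / ‖m n‖ ^ 2 ≤ 4 / a * (n : ℝ) ^ (2 * θ - 2) := by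
    filter_upwards [h.lower, h.tendsto_q.eventually_le_const one_pos, eventually_gt_atTop 0]
      with n hn hq hn0
    have hn0' : (0 : ℝ) < n := by exact_mod_cast hn0
    have ha := h.pos
    have hp : 0 < a * (n : ℝ) ^ (1 - 2 * θ) := by positivity
    have hm : 0 < ‖m n‖ ^ 2 := hp.trans_le hn
    have hq0 : 0 ≤ (n : ℝ) ^ (-2 * θ) := by positivity
    have key : 4 * (1 / (n : ℝ)) / ‖m n‖ ^ 2 ≤ 4 / a * (n : ℝ) ^ (2 * θ - 2) := by
      calc 4 * (1 / (n : ℝ)) / ‖m n‖ ^ 2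
          ≤ 4 * (1 / (n : ℝ)) / (a * (n : ℝ) ^ (1 - 2 * θ)) := by gcongr
        _ = 4 / a * ((n : ℝ) * (n : ℝ) ^ (1 - 2 * θ))⁻¹ := by field_simp
        _ = 4 / a * (n : ℝ) ^ (2 * θ - 2) := by
          rw [natCast_mul_rpow hn0, ← Real.rpow_neg hn0'.le]
          congr 2; ring
    refine ⟨fun h0 => by simp [h0] at hm, div_nonneg (by linarith) hn0'.le, ?_, key⟩
    refine le_trans ?_ key
    gcongr
    linarith
  constructor
  · refine tendsto_of_tendsto_of_tendsto_of_le_of_le' tendsto_const_nhds hδ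
      (Eventually.of_forall fun _ => measureReal_nonneg) ?_
    filter_upwards [hbound] with n ⟨hm, hs, h1, _⟩
    exact ENNReal.toReal_le_of_le_ofReal ((by positivity : (0:ℝ) ≤ _).trans h1)
      ((isoGaussian_halfSpace_compl_le hs hm).trans (ENNReal.ofReal_le_ofReal h1))
  · refine tendsto_of_tendsto_of_tendsto_of_le_of_le' tendsto_const_nhds hδ
      (Eventually.of_forall fun _ => measureReal_nonneg) ?_
    filter_upwards [hbound] with n ⟨hm, _, _, h1⟩
    exact ENNReal.toReal_le_of_le_ofReal ((by positivity : (0:ℝ) ≤ _).trans h1)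
      ((isoGaussian_zero_halfSpace_le (by positivity) hm).trans (ENNReal.ofReal_le_ofReal h1))

/-- For `τ = 1 / n` and `s = (1 - q) / n` the exact formula is `(1 - q²) ^ (-n/2) * exp (n ‖m‖² / (1
+ q)) - 1`. The two factors are at most `exp (n q²)` and `exp (n ‖m‖²)`. -/
lemma tendsto_chiSquare_zero (hθ : 1 < θ) :
    Tendsto (fun n => chiSquare (ouLaw θ m n) (equilibrium n)) atTop (𝓝 0) := by
  have hlim : Tendsto (fun n : ℕ => ENNReal.ofReal (Real.exp ((n : ℝ) ^ (1 - 4 * θ)) *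
      Real.exp (b * (n : ℝ) ^ (2 - 2 * θ)) - 1)) atTop (𝓝 0) := by
    rw [← ENNReal.ofReal_zero]
    refine ENNReal.tendsto_ofReal ?_
    have e1 := (tendsto_natCast_rpow_zero (by linarith : 1 - 4 * θ < 0)).rexp
    have e2 := ((tendsto_natCast_rpow_zero (by linarith : 2 - 2 * θ < 0)).const_mul b).rexp
    simpa using (e1.mul e2).sub_const 1
  refine tendsto_of_tendsto_of_tendsto_of_le_of_le' tendsto_const_nhds hlim
    (Eventually.of_forall fun _ => zero_le) ?_
  filter_upwards [h.upper, h.tendsto_q.eventually_le_const (by norm_num : (0 : ℝ) < 1 / 2),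
    eventually_gt_atTop 0] with n hn hq hn0
  have hn0' : (0 : ℝ) < n := by exact_mod_cast hn0
  have hqpos : 0 < (n : ℝ) ^ (-2 * θ) := by positivity
  have hqsq : (n : ℝ) * ((n : ℝ) ^ (-2 * θ)) ^ 2 = (n : ℝ) ^ (1 - 4 * θ) := by
    rw [← Real.rpow_natCast, ← Real.rpow_mul hn0'.le, natCast_mul_rpow hn0]
    congr 1; push_cast; ring
  set q := (n : ℝ) ^ (-2 * θ) with hqdef
  have hq2 : q ^ 2 ≤ 1 / 2 := by nlinarith
  rw [equilibrium, chiSquare_isoGaussian (div_pos (by linarith) hn0') (by positivity)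
    (by rw [← mul_div_assoc]; gcongr; linarith)]
  refine ENNReal.ofReal_le_ofReal (sub_le_sub_right (mul_le_mul ?_ ?_ (Real.exp_pos _).le
    (Real.exp_pos _).le) 1)
  · have e1 :
        (1 / (n : ℝ)) ^ 2 / ((1 - q) / n * (2 * (1 / n) - (1 - q) / n)) = 1 / (1 - q ^ 2) := by
      have : 1 - q ≠ 0 := by linarith
      have : 1 + q ≠ 0 := by positivity
      rw [show (2 * (1 / (n : ℝ)) - (1 - q) / n) = (1 + q) / n by ring,
        show 1 - q ^ 2 = (1 - q) * (1 + q) by ring]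
      field_simp
    -- `(1 + 2q²)(1 - q²) ≥ 1` as soon as `q² ≤ 1/2`.
    have e2 : 1 / (1 - q ^ 2) ≤ Real.exp (2 * q ^ 2) := by
      refine le_trans ?_ (Real.add_one_le_exp _)
      rw [div_le_iff₀ (by linarith)]
      nlinarith [sq_nonneg q]
    rw [e1, ← hqsq]
    refine (Real.rpow_le_rpow (one_div_nonneg.2 (by linarith)) e2 (by positivity)).trans
      (le_of_eq ?_)
    rw [← Real.exp_mul]
    congr 1; ring
  · refine Real.exp_le_exp.2 ?_
    rw [show (2 * (1 / (n : ℝ)) - (1 - q) / n) = (1 + q) / n by ring]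
    calc ‖m n‖ ^ 2 / ((1 + q) / n) ≤ ‖m n‖ ^ 2 / (1 / n) := by
          gcongr; linarith
      _ = n * ‖m n‖ ^ 2 := by field_simp
      _ ≤ n * (b * (n : ℝ) ^ (1 - 2 * θ)) := by gcongr
      _ = b * ((n : ℝ) * (n : ℝ) ^ (1 - 2 * θ)) := by ring
      _ = b * (n : ℝ) ^ (2 - 2 * θ) := by
          rw [natCast_mul_rpow hn0]; congr 2; ring

lemma fisher_eq : ∀ᶠ n : ℕ in atTop, fisher (ouLaw θ m n) (equilibrium n) =
    ENNReal.ofReal ((n : ℝ) ^ 2 * ‖m n‖ ^ 2 +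
      (n : ℝ) ^ 2 * ((n : ℝ) ^ (-2 * θ)) ^ 2 / (1 - (n : ℝ) ^ (-2 * θ))) := by
  filter_upwards [h.tendsto_q.eventually_lt_const one_pos, eventually_gt_atTop 0] with n hq hn0
  have hn0' : (0 : ℝ) < n := by exact_mod_cast hn0
  have hq' : 0 < 1 - (n : ℝ) ^ (-2 * θ) := by linarith
  rw [equilibrium, fisher_isoGaussian (div_pos hq' hn0') (by positivity), norm_smul, mul_pow,
    Real.norm_eq_abs, sq_abs]
  congr 1
  have hq'' := hq'.ne'
  generalize (n : ℝ) ^ (-2 * θ) = q at hq''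
  field_simp
  ring

lemma tendsto_fisher_top (hθ : θ < 3 / 2) :
    Tendsto (fun n => fisher (ouLaw θ m n) (equilibrium n)) atTop (𝓝 ∞) := by
  have h1 : Tendsto (fun n : ℕ => ENNReal.ofReal (a * (n : ℝ) ^ (3 - 2 * θ))) atTop (𝓝 ∞) :=
    ENNReal.tendsto_ofReal_atTop.comp
      ((tendsto_natCast_rpow_atTop (by linarith : 0 < 3 - 2 * θ)).const_mul_atTop h.pos)
  refine tendsto_nhds_top_mono h1 ?_
  filter_upwards [h.fisher_eq, h.lower, h.tendsto_q.eventually_lt_const one_pos,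
    eventually_gt_atTop 0] with n hf hn hq hn0
  have hn0' : (0 : ℝ) < n := by exact_mod_cast hn0
  have hq' : 0 < 1 - (n : ℝ) ^ (-2 * θ) := by linarith
  rw [hf]
  refine ENNReal.ofReal_le_ofReal ?_
  have e : a * (n : ℝ) ^ (3 - 2 * θ) = (n : ℝ) ^ 2 * (a * (n : ℝ) ^ (1 - 2 * θ)) := by
    rw [mul_left_comm, ← Real.rpow_natCast, ← Real.rpow_add hn0']
    congr 2; push_cast; ring
  rw [e]
  have := mul_le_mul_of_nonneg_left hn (sq_nonneg (n : ℝ))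
  have : 0 ≤ (n : ℝ) ^ 2 * ((n : ℝ) ^ (-2 * θ)) ^ 2 / (1 - (n : ℝ) ^ (-2 * θ)) := by positivity
  linarith

lemma tendsto_fisher_zero (hθ : 3 / 2 < θ) :
    Tendsto (fun n => fisher (ouLaw θ m n) (equilibrium n)) atTop (𝓝 0) := by
  have hlim : Tendsto (fun n : ℕ => ENNReal.ofReal (b * (n : ℝ) ^ (3 - 2 * θ) +
      2 * (n : ℝ) ^ (2 - 4 * θ))) atTop (𝓝 0) := by
    rw [← ENNReal.ofReal_zero]
    refine ENNReal.tendsto_ofReal ?_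
    have e1 := (tendsto_natCast_rpow_zero (by linarith : 3 - 2 * θ < 0)).const_mul b
    have e2 := (tendsto_natCast_rpow_zero (by linarith : 2 - 4 * θ < 0)).const_mul 2
    simpa using e1.add e2
  refine tendsto_of_tendsto_of_tendsto_of_le_of_le' tendsto_const_nhds hlim
    (Eventually.of_forall fun _ => zero_le) ?_
  filter_upwards [h.fisher_eq, h.upper,
    h.tendsto_q.eventually_le_const (by norm_num : (0 : ℝ) < 1 / 2),
    eventually_gt_atTop 0] with n hf hn hq hn0
  have hn0' : (0 : ℝ) < n := by exact_mod_cast hn0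
  rw [hf]
  refine ENNReal.ofReal_le_ofReal (add_le_add ?_ ?_)
  · have e : b * (n : ℝ) ^ (3 - 2 * θ) = (n : ℝ) ^ 2 * (b * (n : ℝ) ^ (1 - 2 * θ)) := by
      rw [mul_left_comm, ← Real.rpow_natCast, ← Real.rpow_add hn0']
      congr 2; push_cast; ring
    rw [e]
    gcongr
  · have e : (n : ℝ) ^ (2 - 4 * θ) = (n : ℝ) ^ 2 * ((n : ℝ) ^ (-2 * θ)) ^ 2 := by
      rw [← Real.rpow_natCast, ← Real.rpow_natCast, ← Real.rpow_mul hn0'.le,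
        ← Real.rpow_add hn0']
      congr 1; push_cast; ring
    -- The factor `2` absorbs `1 / (1 - q)`, since `q ≤ 1/2`.
    rw [e, div_le_iff₀ (by linarith)]
    have : 0 ≤ (n : ℝ) ^ 2 * ((n : ℝ) ^ (-2 * θ)) ^ 2 := by positivity
    nlinarith

end IsOUScaling

/-- The cutoff time of `D` in dimension `n` is `D.exponent * log n`. -/
noncomputable def Discrepancy.exponent : Discrepancy → ℝ
  | wasserstein => 1 / 2
  | totalVariation => 1
  | hellinger => 1
  | kullback => 1
  | chiSquare => 1
  | fisher => 3 / 2

lemma Discrepancy.cutoffTime_eq (D : Discrepancy) (n : ℕ) :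
    D.cutoffTime n = D.exponent * Real.log n := by
  cases D <;> simp [cutoffTime, exponent]

lemma Discrepancy.exponent_pos (D : Discrepancy) : 0 < D.exponent := by
  cases D <;> norm_num [exponent]

theorem IsOUScaling.tendsto_eval_max (h : IsOUScaling θ a b m) (D : Discrepancy)
    (hθ : θ < D.exponent) :
    Tendsto (fun n => D.eval (ouLaw θ m n) (equilibrium n)) atTop (𝓝 D.max) := by
  have hA : ∀ n : ℕ, MeasurableSet {x : EuclideanSpace ℝ (Fin n) | ‖m n‖ ^ 2 / 2 ≤ ⟪m n, x⟫} :=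
    fun n => measurableSet_le measurable_const (by fun_prop)
  cases D with
  | wasserstein => exact h.tendsto_wasserstein_top hθ
  | totalVariation => exact tendsto_totalVariation_one hA (h.separated hθ).1 (h.separated hθ).2
  | hellinger => exact tendsto_hellinger_one hA (h.separated hθ).1 (h.separated hθ).2
  | kullback => exact tendsto_klDiv_top hA (h.separated hθ).1 (h.separated hθ).2
  | chiSquare => exact tendsto_chiSquare_top hA (h.separated hθ).1 (h.separated hθ).2
  | fisher => exact h.tendsto_fisher_top hθ

theorem IsOUScaling.tendsto_eval_zero (h : IsOUScaling θ a b m) (D : Discrepancy)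
    (hθ : D.exponent < θ) :
    Tendsto (fun n => D.eval (ouLaw θ m n) (equilibrium n)) atTop (𝓝 0) := by
  cases D with
  | wasserstein => exact h.tendsto_wasserstein_zero hθ
  | totalVariation => exact tendsto_totalVariation_zero (h.tendsto_chiSquare_zero hθ)
  | hellinger => exact tendsto_hellinger_zero (h.tendsto_chiSquare_zero hθ)
  | kullback => exact tendsto_klDiv_zero (h.tendsto_chiSquare_zero hθ)
  | chiSquare => exact h.tendsto_chiSquare_zero hθ
  | fisher => exact h.tendsto_fisher_zero hθ

end Asymptotics

/-! ### The Ornstein-Uhlenbeck process at a multiple of the cutoff time -/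

lemma exists_eventually_bounds {u : ℕ → ℝ} (hu : ∀ n, 0 ≤ u n)
    (hinf : 0 < liminf (fun n => ENNReal.ofReal (u n)) atTop)
    (hsup : limsup (fun n => ENNReal.ofReal (u n)) atTop < ∞) :
    ∃ a b : ℝ, 0 < a ∧ ∀ᶠ n in atTop, a ≤ u n ∧ u n ≤ b := by
  obtain ⟨c, hc0, hc⟩ := exists_between hinf
  obtain ⟨d, hd, hd1⟩ := exists_between hsup
  refine ⟨c.toReal, d.toReal, ENNReal.toReal_pos hc0.ne' hc.ne_top, ?_⟩
  filter_upwards [eventually_lt_of_lt_liminf hc, eventually_lt_of_limsup_lt hd] with n h1 h2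
  exact ⟨((ENNReal.lt_ofReal_iff_toReal_lt hc.ne_top).1 h1).le,
    ((ENNReal.ofReal_lt_iff_lt_toReal (hu n) hd1.ne).1 h2).le⟩

lemma isOUScaling_smul {z : ∀ n : ℕ, EuclideanSpace ℝ (Fin n)} {θ a b : ℝ} (hθ : 0 < θ)
    (ha : 0 < a) (hz : ∀ᶠ n : ℕ in atTop, a ≤ ‖z n‖ ^ 2 / n ∧ ‖z n‖ ^ 2 / n ≤ b) :
    IsOUScaling θ a b fun n => (n : ℝ) ^ (-θ) • z n := by
  have hnorm : ∀ᶠ n : ℕ in atTop, ‖(n : ℝ) ^ (-θ) • z n‖ ^ 2 =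
      ‖z n‖ ^ 2 / n * (n : ℝ) ^ (1 - 2 * θ) := by
    filter_upwards [eventually_gt_atTop 0] with n hn
    have hn' : (0 : ℝ) < n := by exact_mod_cast hn
    rw [norm_smul, mul_pow, Real.norm_eq_abs, sq_abs, ← Real.rpow_natCast, ← Real.rpow_mul hn'.le,
      show 1 - 2 * θ = 1 + -θ * (2 : ℕ) by push_cast; ring, ← natCast_mul_rpow hn]
    field_simp
  refine ⟨hθ, ha, ?_, ?_⟩
  · filter_upwards [hnorm, hz] with n h1 h2
    rw [h1]
    exact mul_le_mul_of_nonneg_right h2.1 (by positivity)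
  · filter_upwards [hnorm, hz] with n h1 h2
    rw [h1]
    exact mul_le_mul_of_nonneg_right h2.2 (by positivity)

lemma IsOrnsteinUhlenbeck.map_log_eq {n : ℕ} {Ω : Type*} [MeasurableSpace Ω] {P : Measure Ω}
    [IsProbabilityMeasure P] {z : EuclideanSpace ℝ (Fin n)}
    {Z : ℝ≥0 → Ω → EuclideanSpace ℝ (Fin n)} (hZ : IsOrnsteinUhlenbeck z Z P) {θ : ℝ}
    (hθ : 0 < θ) (hn : 1 < n) :
    P.map (Z (θ * Real.log n).toNNReal) =
      isoGaussian ((n : ℝ) ^ (-θ) • z) ((1 - (n : ℝ) ^ (-2 * θ)) / n) := by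
  have hn' : (1 : ℝ) < n := by exact_mod_cast hn
  have hn0 : (0 : ℝ) < n := by linarith
  rw [hZ.map_eq (mul_pos hθ (Real.log_pos hn')), Real.rpow_def_of_pos hn0,
    Real.rpow_def_of_pos hn0]
  congr 4 <;> ring_nf

end OUCutoff

/-! ### The cutoff theorem. -/

theorem theorem1p1 {Ω : ℕ → Type*} [∀ n, MeasurableSpace (Ω n)]
    (P : ∀ n, Measure (Ω n)) [∀ n, IsProbabilityMeasure (P n)]
    (z : ∀ n : ℕ, EuclideanSpace ℝ (Fin n))
    (Z : ∀ n : ℕ, ℝ≥0 → Ω n → EuclideanSpace ℝ (Fin n))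
    (hZ : ∀ n : ℕ, 1 ≤ n → OUCutoff.IsOrnsteinUhlenbeck (z n) (Z n) (P n))
    (hinf : 0 < liminf (fun n : ℕ => ENNReal.ofReal (‖z n‖ ^ 2 / (n : ℝ))) atTop)
    (hsup : limsup (fun n : ℕ => ENNReal.ofReal (‖z n‖ ^ 2 / (n : ℝ))) atTop < ∞)
    (D : OUCutoff.Discrepancy) (ε : ℝ) (hε0 : 0 < ε) (hε1 : ε < 1) :
    Tendsto (fun n : ℕ =>
        D.eval ((P n).map (Z n ((1 - ε) * D.cutoffTime n).toNNReal)) (OUCutoff.equilibrium n))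
      atTop (𝓝 D.max) ∧
    Tendsto (fun n : ℕ =>
        D.eval ((P n).map (Z n ((1 + ε) * D.cutoffTime n).toNNReal)) (OUCutoff.equilibrium n))
      atTop (𝓝 0) := by
  obtain ⟨a, b, ha, hz⟩ :=
    OUCutoff.exists_eventually_bounds (fun n => by positivity) hinf hsup
  have hD := D.exponent_pos
  have hlaw : ∀ r : ℝ, 0 < r → (fun n : ℕ =>
      D.eval (OUCutoff.ouLaw (r * D.exponent) (fun n => (n : ℝ) ^ (-(r * D.exponent)) • z n) n)
        (OUCutoff.equilibrium n)) =ᶠ[atTop] fun n : ℕ =>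
      D.eval ((P n).map (Z n (r * D.cutoffTime n).toNNReal)) (OUCutoff.equilibrium n) := by
    intro r hr
    -- At `n = 1` the cutoff time is `0` and the law is still a Dirac mass; `n > 1` makes the time
    -- positive.
    filter_upwards [eventually_gt_atTop 1] with n hn
    rw [D.cutoffTime_eq, ← mul_assoc, (hZ n hn.le).map_log_eq (mul_pos hr hD) hn]
  constructor
  · have hr : 0 < 1 - ε := by linarith
    refine Tendsto.congr' (hlaw _ hr) ((OUCutoff.isOUScaling_smul (mul_pos hr hD) ha
      hz).tendsto_eval_max D ?_)
    nlinarith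
  · have hr : 0 < 1 + ε := by linarith
    refine Tendsto.congr' (hlaw _ hr) ((OUCutoff.isOUScaling_smul (mul_pos hr hD) ha
      hz).tendsto_eval_zero D ?_)
    nlinarith
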